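/- **Conventions.** A Boolean circuit is a directed acyclic graph of constant, NOT, AND and OR gates of fan-in at most two; its size is its number of gates. An instance of $k$-SAT is a list of $m$ clauses, each a disjunction of $k$ literals over $n$ variables, and one asks whether some assignment satisfies all clauses; an instance of Max-$k$-SAT has in addition a threshold $W\in\{0,\dots,m\}$, and one asks whether some assignment satisfies at least $W$ clauses. A family of circuits for these problems has one circuit for each pair $(n,m)$, and "size $T(n)$" means at most $T(n)\cdot (n+m+2)^{c}$ for some constant $c$. * *Non-uniform SETH* (resp. *non-uniform Max-SAT-SETH*): for every $\varepsilon>0$ there is an integer $k\ge 1$ such that no family of circuits of size $2^{(1-\varepsilon)n}$ solves $k$-SAT (resp. Max-$k$-SAT). * *Non-uniform ETH* (resp. *non-uniform Max-SAT-ETH*): no family of circuits of size $2^{o(n)}$ solves 3-SAT (resp. Max-3-SAT). For $1\le p\le\infty$ and $\gamma\ge 1$, the problem $\gamma$-$\mathrm{CVPP}_p$ is the following. A preprocessing function $P$ (arbitrary, at no cost) maps a basis $B\in\mathbb Q^{d\times n}$ of a rank-$n$ lattice $\mathcal L=B\mathbb Z^n\subset\mathbb R^d$ to a bit string $P(B)$.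 The query algorithm $Q$ (a family of circuits, indexed by $n$, $d$, the bit length $b$ of the numbers in the instance, and the length of $P(B)$) receives $P(B)$, a target $t\in\mathbb Q^d$ and a number $r\in\mathbb Q$, $r>0$, all rationals being given by the binary expansions of numerator and denominator, and must accept if $\operatorname{dist}_p(\mathcal L,t)\le r$ and reject if $\operatorname{dist}_p(\mathcal L,t)>\gamma r$. $\mathrm{CVPP}_p$ is the case $\gamma=1$. A $T(n)$-time algorithm is a pair $(P,Q)$ such that, for some constant $c$, the size of the circuit of $Q$ plus the length $|P(B)|$ is at most $T(n)\cdot(n+d+b+2)^{c}$ for every basis $B$. For $1\le p\le\infty$ and $k\ge1$, a matrix $V\in\mathbb R^{d\times k}$ and $t^*\in\mathbb R^d$ define a *$(p,k)$-isolating parallelepiped* if $\|Vx-t^*\|_p=1$ for all $x\in\{0,1\}^k\setminus\{0\}$ and $\|t^*\|_p>1$; and $V,t_{\rm on},t_{\rm off}$ define a *$(p,k)$-on-off isolating parallelepiped* if $V,t_{\rm on}$ define a $(p,k)$-isolating parallelepiped and $\|Vx-t_{\rm off}\|_p=1$ for all $x\in\{0,1\}^k$. **Theorem.** 1. For every $p\in[1,\infty)\setminus2\mathbb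 Z$ and $\varepsilon>0$, there is no $2^{(1-\varepsilon)n}$-time algorithm for $\mathrm{CVPP}_p$ assuming non-uniform Max-SAT-SETH. In particular, there is none assuming non-uniform SETH. 2. For every $p\in[1,\infty)$ with $p\ne2$, there is no $2^{o(n)}$-time algorithm for $\mathrm{CVPP}_p$ assuming non-uniform Max-SAT-ETH. In particular, there is none assuming non-uniform ETH. There is also no $2^{o(n)}$-time algorithm for $\mathrm{CVPP}_\infty$ assuming non-uniform ETH. 3. For every $\varepsilon>0$ there exists $\gamma(\varepsilon)>1$ such that there is no $2^{(1-\varepsilon)n}$-time algorithm for $\gamma(\varepsilon)$-$\mathrm{CVPP}_\infty$ assuming non-uniform SETH. 4. For every $p\in[1,\infty)$ and integer $k\ge1$, a $(p,k)$-on-off isolating parallelepiped exists if and only if a $(p,k+1)$-isolating parallelepiped exists; and one with computable real entries exists if and only if a $(p,k+1)$-isolating parallelepiped with computable real entries exists. -/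

import Mathlib

open Filter Asymptotics

namespace CVPP

/-! ### Boolean circuits -/

/-- A Boolean gate of fan-in at most two whose arguments are wires named by `α`. -/
inductive Gate (α : Type) : Type
  | const (b : Bool) : Gate α
  | not (a : α) : Gate α
  | and (a b : α) : Gate α
  | or (a b : α) : Gate α

/-- The value of a gate, given the values of the wires. -/
def Gate.eval {α : Type} (v : α → Bool) : Gate α → Bool
  | .const b => b
  | .not a => !(v a)
  | .and a b => v a && v b
  | .or a b => v a || v b

/-- A topologically ordered list of `s` gates over the inputs `ι`: the arguments of a gate are inputs
or gates that come earlier in the list. -/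
inductive GateList (ι : Type) : ℕ → Type
  | nil : GateList ι 0
  | snoc {s : ℕ} (C : GateList ι s) (g : Gate (ι ⊕ Fin s)) : GateList ι (s + 1)

/-- The values of all gates of the list on the input `x`. -/
def GateList.eval {ι : Type} (x : ι → Bool) : {s : ℕ} → GateList ι s → Fin s → Bool
  | _, .nil => Fin.elim0
  | _, .snoc C g =>
      Fin.snoc (α := fun _ => Bool) (GateList.eval x C)
        (g.eval (Sum.elim x (GateList.eval x C)))

/-- A Boolean circuit with input bits `ι` and one output bit. Its size is the number of its gates. -/
structure Circuit (ι : Type) where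
  size : ℕ
  gates : GateList ι size
  out : ι ⊕ Fin size

/-- The output bit of the circuit on the input `x`. -/
def Circuit.eval {ι : Type} (C : Circuit ι) (x : ι → Bool) : Bool :=
  Sum.elim x (C.gates.eval x) C.out

/-! ### `k`-SAT and Max-`k`-SAT -/

/-- A literal over the variables `0, …, n - 1`: `(j, true)` is `x_j` and `(j, false)` is `¬ x_j`. -/
abbrev Literal (n : ℕ) : Type := Fin n × Bool

/-- A `k`-SAT formula with `m` clauses over `n` variables: a list of clauses, each a `k`-tuple of
literals (clauses may be repeated, and so may variables inside a clause). -/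
abbrev Formula (k n m : ℕ) : Type := Fin m → Fin k → Literal n

/-- The assignment `y` satisfies the disjunction of the literals `c`. -/
abbrev SatisfiesClause {k n : ℕ} (y : Fin n → Bool) (c : Fin k → Literal n) : Prop :=
  ∃ s, y (c s).1 = (c s).2

/-- `m⁺(y)`: the number of clauses of `Φ` that the assignment `y` satisfies. -/
def numSatisfied {k n m : ℕ} (Φ : Formula k n m) (y : Fin n → Bool) : ℕ :=
  (Finset.univ.filter fun i => SatisfiesClause y (Φ i)).card

/-- The input bits that describe a formula: one bit for each position and each literal. -/
abbrev FormulaBits (k n m : ℕ) : Type := Fin m × Fin k × Literal n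

/-- The encoding of a formula: the bit `(i, s, ℓ)` says whether the `s`-th literal of the `i`-th
clause is `ℓ`. -/
def Formula.encode {k n m : ℕ} (Φ : Formula k n m) : FormulaBits k n m → Bool :=
  fun b => decide (Φ b.1 b.2.1 = b.2.2)

/-- The encoding of a Max-`k`-SAT instance `(Φ, W)`: the formula and the threshold `W ≤ m` (the
latter with one bit for each possible value). -/
def encodeMax {k n m : ℕ} (Φ : Formula k n m) (W : Fin (m + 1)) :
    FormulaBits k n m ⊕ Fin (m + 1) → Bool :=
  Sum.elim (Formula.encode Φ) fun w => decide (W = w)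

/-- A family of circuits for `k`-SAT: one circuit for each number `n` of variables and each number
`m` of clauses. -/
abbrev SatFamily (k : ℕ) : Type := ∀ n m : ℕ, Circuit (FormulaBits k n m)

/-- A family of circuits for Max-`k`-SAT. -/
abbrev MaxSatFamily (k : ℕ) : Type := ∀ n m : ℕ, Circuit (FormulaBits k n m ⊕ Fin (m + 1))

/-- The family decides whether a `k`-SAT formula has a satisfying assignment. -/
def SatFamily.Solves {k : ℕ} (C : SatFamily k) : Prop :=
  ∀ (n m : ℕ) (Φ : Formula k n m),
    (C n m).eval (Formula.encode Φ) = true ↔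
      ∃ y : Fin n → Bool, ∀ i, SatisfiesClause y (Φ i)

/-- The family decides whether some assignment satisfies at least `W` clauses of `Φ`. -/
def MaxSatFamily.Solves {k : ℕ} (C : MaxSatFamily k) : Prop :=
  ∀ (n m : ℕ) (Φ : Formula k n m) (W : Fin (m + 1)),
    (C n m).eval (encodeMax Φ W) = true ↔
      ∃ y : Fin n → Bool, (W : ℕ) ≤ numSatisfied Φ y

/-- The family has size `T n` up to a factor polynomial in the instance size. -/
def SatFamily.HasSize {k : ℕ} (C : SatFamily k) (T : ℕ → ℝ) : Prop :=
  ∃ c : ℕ, ∀ n m : ℕ, ((C n m).size : ℝ) ≤ T n * ((n + m + 2 : ℕ) : ℝ) ^ c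

/-- The family has size `T n` up to a factor polynomial in the instance size. -/
def MaxSatFamily.HasSize {k : ℕ} (C : MaxSatFamily k) (T : ℕ → ℝ) : Prop :=
  ∃ c : ℕ, ∀ n m : ℕ, ((C n m).size : ℝ) ≤ T n * ((n + m + 2 : ℕ) : ℝ) ^ c

/-! ### Hardness assumptions -/

/-- The function `n ↦ 2 ^ ((1 - ε) n)`. -/
noncomputable def expBound (ε : ℝ) : ℕ → ℝ := fun n => (2 : ℝ) ^ ((1 - ε) * (n : ℝ))

/-- The function `n ↦ 2 ^ (f n)`. -/
noncomputable def twoPow (f : ℕ → ℝ) : ℕ → ℝ := fun n => (2 : ℝ) ^ f n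

/-- Non-uniform SETH. -/
def NonuniformSETH : Prop :=
  ∀ ε : ℝ, 0 < ε → ∃ k : ℕ, 1 ≤ k ∧
    ¬ ∃ C : SatFamily k, C.Solves ∧ C.HasSize (expBound ε)

/-- Non-uniform Max-SAT-SETH. -/
def NonuniformMaxSatSETH : Prop :=
  ∀ ε : ℝ, 0 < ε → ∃ k : ℕ, 1 ≤ k ∧
    ¬ ∃ C : MaxSatFamily k, C.Solves ∧ C.HasSize (expBound ε)

/-- Non-uniform ETH: 3-SAT has no circuits of size `2 ^ o(n)`. -/
def NonuniformETH : Prop :=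
  ¬ ∃ (C : SatFamily 3) (f : ℕ → ℝ),
    f =o[atTop] (fun n : ℕ => (n : ℝ)) ∧ C.Solves ∧ C.HasSize (twoPow f)

/-- Non-uniform Max-SAT-ETH: Max-3-SAT has no circuits of size `2 ^ o(n)`. -/
def NonuniformMaxSatETH : Prop :=
  ¬ ∃ (C : MaxSatFamily 3) (f : ℕ → ℝ),
    f =o[atTop] (fun n : ℕ => (n : ℝ)) ∧ C.Solves ∧ C.HasSize (twoPow f)

/-! ### Lattices and the Closest Vector Problem with Preprocessing -/

/-- The `ℓ_p` norm on `ℝ ^ d`. -/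
noncomputable def lpNorm (p : ENNReal) {d : ℕ} (v : Fin d → ℝ) : ℝ :=
  ‖(WithLp.toLp p v : PiLp p fun _ : Fin d => ℝ)‖

/-- The set `B ℤ ^ n` of integer combinations of the columns of `B`. -/
def latticeOf {d n : ℕ} (B : Matrix (Fin d) (Fin n) ℝ) : Set (Fin d → ℝ) :=
  Set.range fun z : Fin n → ℤ => B.mulVec fun j => (z j : ℝ)

/-- `dist_p(L, t)`, the `ℓ_p` distance from `t` to `L`. -/
noncomputable def lpDist (p : ENNReal) {d : ℕ} (L : Set (Fin d → ℝ)) (t : Fin d → ℝ) : ℝ :=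
  sInf ((fun x => lpNorm p (x - t)) '' L)

/-- Numerator and denominator of the rational number `q` have at most `b` binary digits. -/
def FitsIn (b : ℕ) (q : ℚ) : Prop := q.num.natAbs < 2 ^ b ∧ q.den < 2 ^ b

/-- The bits of a rational number: a sign bit and `b` bits each for numerator and denominator. -/
abbrev RatBits (b : ℕ) : Type := Unit ⊕ (Fin b ⊕ Fin b)

/-- The binary encoding of a rational number. -/
def encodeRat (b : ℕ) (q : ℚ) : RatBits b → Bool
  | .inl _ => decide (q < 0)
  | .inr (.inl i) => q.num.natAbs.testBit i
  | .inr (.inr i) => q.den.testBit i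

/-- The bits of a query: a target vector in `ℚ ^ d` and a distance bound. -/
abbrev QueryBits (d b : ℕ) : Type := (Fin d × RatBits b) ⊕ RatBits b

/-- The binary encoding of a query `(t, r)`. -/
def encodeQuery {d : ℕ} (b : ℕ) (t : Fin d → ℚ) (r : ℚ) : QueryBits d b → Bool :=
  Sum.elim (fun x => encodeRat b (t x.1) x.2) (encodeRat b r)

/-- `B` is a basis of a lattice of rank `n` in `ℝ ^ d`, with rational entries of bit length at
most `b`. -/
def IsBasis {d n : ℕ} (b : ℕ) (B : Matrix (Fin d) (Fin n) ℚ) : Prop :=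
  LinearIndependent ℝ (fun (j : Fin n) (i : Fin d) => ((B i j : ℚ) : ℝ)) ∧
    ∀ i j, FitsIn b (B i j)

/-- A (non-uniform) algorithm for lattice problems with preprocessing: an arbitrary preprocessing
function, which maps a basis to a bit string, and a family of query circuits, which read that string
and a query. There is one circuit for each rank `n`, dimension `d`, bit length `b` of the numbers and
length `a` of the preprocessed string. -/
structure Algorithm where
  preprocess : ∀ {n d : ℕ}, Matrix (Fin d) (Fin n) ℚ → List Bool
  query : ∀ (_n d b a : ℕ), Circuit (Fin a ⊕ QueryBits d b)

/-- The answer of the algorithm on the basis `B` and the query `(t, r)` of bit length `b`. -/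
def Algorithm.answer (A : Algorithm) {n d : ℕ} (b : ℕ) (B : Matrix (Fin d) (Fin n) ℚ)
    (t : Fin d → ℚ) (r : ℚ) : Bool :=
  (A.query n d b (A.preprocess B).length).eval
    (Sum.elim (A.preprocess B).get (encodeQuery b t r))

/-- The algorithm solves `γ`-approximate `CVPP_p`: it accepts if `dist_p(L, t) ≤ r` and rejects if
`dist_p(L, t) > γ r`. For `γ = 1` this is (exact) `CVPP_p`. -/
def Algorithm.Solves (A : Algorithm) (p : ENNReal) (γ : ℝ) : Prop :=
  ∀ (n d b : ℕ) (B : Matrix (Fin d) (Fin n) ℚ) (t : Fin d → ℚ) (r : ℚ),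
    IsBasis b B → (∀ i, FitsIn b (t i)) → FitsIn b r → 0 < r →
      (lpDist p (latticeOf (B.map fun q => (q : ℝ))) (fun i => (t i : ℝ)) ≤ (r : ℝ) →
        A.answer b B t r = true) ∧
      (γ * (r : ℝ) < lpDist p (latticeOf (B.map fun q => (q : ℝ))) (fun i => (t i : ℝ)) →
        A.answer b B t r = false)

/-- On lattices of rank `n`, the size of the query circuits and of the preprocessed string are at most
`T n`, up to a factor polynomial in the instance size. The time of the preprocessing itself is not
counted. -/
def Algorithm.RunsIn (A : Algorithm) (T : ℕ → ℝ) : Prop :=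
  ∃ c : ℕ, ∀ (n d b : ℕ) (B : Matrix (Fin d) (Fin n) ℚ), IsBasis b B →
    (((A.query n d b (A.preprocess B).length).size + (A.preprocess B).length : ℕ) : ℝ) ≤
      T n * ((n + d + b + 2 : ℕ) : ℝ) ^ c

/-- Some algorithm solves `γ`-approximate `CVPP_p` in time `2 ^ ((1 - ε) n)`. -/
def SolvableInExp (p : ENNReal) (γ ε : ℝ) : Prop :=
  ∃ A : Algorithm, A.Solves p γ ∧ A.RunsIn (expBound ε)

/-- Some algorithm solves `γ`-approximate `CVPP_p` in time `2 ^ o(n)`. -/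
def SolvableInSubexp (p : ENNReal) (γ : ℝ) : Prop :=
  ∃ (A : Algorithm) (f : ℕ → ℝ),
    f =o[atTop] (fun n : ℕ => (n : ℝ)) ∧ A.Solves p γ ∧ A.RunsIn (twoPow f)

/-! ### Isolating parallelepipeds -/

/-- The vector `x` lies in `{0, 1} ^ k`. -/
def IsZeroOne {k : ℕ} (x : Fin k → ℝ) : Prop := ∀ i, x i = 0 ∨ x i = 1

/-- `V` and `t` define a `(p, k)`-isolating parallelepiped. -/
def IsIsolating (p : ENNReal) {d k : ℕ} (V : Matrix (Fin d) (Fin k) ℝ) (t : Fin d → ℝ) : Prop :=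
  (∀ x : Fin k → ℝ, IsZeroOne x → x ≠ 0 → lpNorm p (V.mulVec x - t) = 1) ∧
    1 < lpNorm p t

/-- `V`, `tOn` and `tOff` define a `(p, k)`-on-off isolating parallelepiped. -/
def IsOnOffIsolating (p : ENNReal) {d k : ℕ} (V : Matrix (Fin d) (Fin k) ℝ)
    (tOn tOff : Fin d → ℝ) : Prop :=
  (∀ x : Fin k → ℝ, IsZeroOne x → x ≠ 0 → lpNorm p (V.mulVec x - tOn) = 1) ∧
    1 < lpNorm p tOn ∧
    ∀ x : Fin k → ℝ, IsZeroOne x → lpNorm p (V.mulVec x - tOff) = 1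

/-- The real number `x` is computable: an algorithm outputs, for each `n`, a rational number
(given as `(a n - b n) / (c n + 1)`) at distance at most `2 ^ (-n)` from `x`. -/
def IsComputableReal (x : ℝ) : Prop :=
  ∃ a b c : ℕ → ℕ, Computable a ∧ Computable b ∧ Computable c ∧
    ∀ n : ℕ, |x - ((a n : ℝ) - (b n : ℝ)) / ((c n : ℝ) + 1)| ≤ 1 / 2 ^ n

end CVPP

open CVPP

/-! Hardness comes from a reduction in which the lattice depends only on `n` and `m`, so that its
preprocessing can be hardwired into a SAT circuit. The lattice has a block of coordinates for every
pair of a clause position and one of the `(2n)^k` potential clauses. The formula enters through the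
target alone, which switches on the block of the clause actually present at each position and
switches off all others. Further rows `a (2 z i - 1)` make every non-Boolean point expensive. Each
bit of the query is a small function of the input bits, so an algorithm for CVPP yields circuits
with polynomial overhead (`exists_maxSatFamily`).

For finite `p` a block is an on-off isolating parallelepiped: switched off, it contributes 1 to the
`p`-th power of the distance; switched on, it contributes 1 if the clause is satisfied and `1 + δ`
otherwise. The distance therefore counts satisfied clauses. Its real entries are scaled by a
polynomially large `D` and rounded. Only the existence of these entries matters because the circuits
are non-uniform. For `p = ∞` a one-row block with small integers suffices and leaves the gap `(k +
1) / k`.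

On-off parallelepipeds with `k` columns amount to isolating ones with `k + 1` columns, the
additional column being `tOn - tOff`. To construct isolating ones, consider the functions on the
cube that become sums of `p`-th powers of affine forms after adding a constant. They form a linear
space (`lpSpan`): reflections of the cube supply negative multiples. By Newton's forward difference
formula this space contains all monomials unless some iterated difference of `|s|^p` of order at
most `k` vanishes identically, which forces `p` to be an even integer below `k`
(`exists_even_of_fwdDiff_eq_zero`). Inclusion-exclusion then gives the indicator of the origin. -/

namespace CVPP

/-! ### Composition of circuits -/

/-- Rename the wires of a gate. -/
def Gate.map {α β : Type} (φ : α → β) : Gate α → Gate β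
  | .const b => .const b
  | .not a => .not (φ a)
  | .and a b => .and (φ a) (φ b)
  | .or a b => .or (φ a) (φ b)

theorem Gate.eval_map {α β : Type} (φ : α → β) (v : β → Bool) (g : Gate α) :
    (g.map φ).eval v = g.eval (fun a => v (φ a)) := by
  cases g <;> rfl

/-- The gates of `M` are placed after those of `L`, input `i` of `M` being read off the wire `w i`.
Serial composition uses general `w`; parallel composition lets `w` point to the original inputs. -/
theorem GateList.exists_append {κ ι : Type} {s : ℕ} (L : GateList κ s) (w : ι → κ ⊕ Fin s)
    {r : ℕ} (M : GateList ι r) :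
    ∃ N : GateList κ (s + r), ∀ x, (∀ i, N.eval x (Fin.castAdd r i) = L.eval x i) ∧
      ∀ j, N.eval x (Fin.natAdd s j) = M.eval (fun i => Sum.elim x (L.eval x) (w i)) j := by
  induction M with
  | nil => exact ⟨L, fun x => ⟨fun i => rfl, fun j => j.elim0⟩⟩
  | @snoc r M g ih =>
    obtain ⟨N, hN⟩ := ih
    refine ⟨GateList.snoc N (g.map (Sum.elim
      (fun i => Sum.map id (Fin.castAdd r) (w i)) (fun j => Sum.inr (Fin.natAdd s j)))),
      fun x => ⟨fun i => ?_, fun j => ?_⟩⟩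
    · exact (Fin.snoc_castSucc (α := fun _ => Bool) _ _ (Fin.castAdd r i)).trans ((hN x).1 i)
    · refine Fin.lastCases ?_ (fun j => ?_) j
      · refine (Fin.snoc_last (α := fun _ => Bool) _ _).trans ?_
        refine Eq.trans ?_ (Fin.snoc_last (α := fun _ => Bool) _ _).symm
        rw [Gate.eval_map]
        congr 1
        funext a
        rcases a with i | j
        · simp only [Sum.elim_inl]
          rcases w i with a | b
          · rfl
          · exact (hN x).1 b
        · exact (hN x).2 j
      · refine (Fin.snoc_castSucc (α := fun _ => Bool) _ _ (Fin.natAdd s j)).trans ?_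
        exact ((hN x).2 j).trans (Fin.snoc_castSucc (α := fun _ => Bool) _ _ j).symm

/-- The Boolean map `f` is computed by a circuit with at most `s` gates and several outputs. -/
def Computes {κ ι : Type} (s : ℕ) (f : (κ → Bool) → ι → Bool) : Prop :=
  ∃ r ≤ s, ∃ (L : GateList κ r) (w : ι → κ ⊕ Fin r),
    ∀ x i, Sum.elim x (L.eval x) (w i) = f x i

namespace Computes

variable {κ ι ι' : Type}

theorem mono {s s' : ℕ} {f : (κ → Bool) → ι → Bool} (h : Computes s f) (hs : s ≤ s') :
    Computes s' f := by
  obtain ⟨r, hr, h⟩ := h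
  exact ⟨r, hr.trans hs, h⟩

theorem comp {s r : ℕ} {f : (κ → Bool) → ι → Bool} {g : (ι → Bool) → ι' → Bool}
    (hf : Computes s f) (hg : Computes r g) : Computes (s + r) (fun x => g (f x)) := by
  obtain ⟨s', hs, L, w, hL⟩ := hf
  obtain ⟨r', hr, M, u, hM⟩ := hg
  obtain ⟨N, hN⟩ := L.exists_append w M
  refine ⟨s' + r', by omega, N, fun i => Sum.elim (fun i => Sum.map id (Fin.castAdd r') (w i))
    (fun j => Sum.inr (Fin.natAdd s' j)) (u i), fun x i => ?_⟩
  have hw : (fun i => Sum.elim x (L.eval x) (w i)) = f x := funext (hL x)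
  refine Eq.trans ?_ (hM (f x) i)
  beta_reduce
  rcases u i with a | b
  · simp only [Sum.elim_inl, ← hL x a]
    rcases w a with a | b
    · rfl
    · exact (hN x).1 b
  · exact ((hN x).2 b).trans (by rw [hw]; rfl)

theorem wire (w : ι → κ) : Computes 0 (fun (x : κ → Bool) i => x (w i)) :=
  ⟨0, le_rfl, .nil, fun i => .inl (w i), fun _ _ => rfl⟩

theorem gate (g : Gate κ) : Computes 1 (fun (x : κ → Bool) (_ : Unit) => g.eval x) :=
  ⟨1, le_rfl, .snoc .nil (g.map Sum.inl), fun _ => .inr (Fin.last 0), fun _ _ =>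
    (Gate.eval_map Sum.inl _ g :)⟩

theorem pair {s r : ℕ} {f : (κ → Bool) → ι → Bool} {g : (κ → Bool) → ι' → Bool}
    (hf : Computes s f) (hg : Computes r g) :
    Computes (s + r) (fun x => Sum.elim (f x) (g x)) := by
  obtain ⟨s', hs, L, w, hL⟩ := hf
  obtain ⟨r', hr, M, u, hM⟩ := hg
  obtain ⟨N, hN⟩ := L.exists_append (fun i : κ => .inl i) M
  refine ⟨s' + r', by omega, N, Sum.elim (fun i => Sum.map id (Fin.castAdd r') (w i))
    (fun i => Sum.map id (Fin.natAdd s') (u i)), fun x i => ?_⟩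
  rcases i with i | i
  · simp only [Sum.elim_inl, ← hL x i]
    rcases w i with a | b
    · rfl
    · exact (hN x).1 b
  · simp only [Sum.elim_inr, ← hM x i]
    rcases u i with a | b
    · rfl
    · exact (hN x).2 b

theorem congr {s : ℕ} {f g : (κ → Bool) → ι → Bool} (hf : Computes s f)
    (h : ∀ x i, f x i = g x i) : Computes s g := by
  rwa [show g = f from funext fun x => funext fun i => (h x i).symm]

theorem reindex {s : ℕ} {f : (κ → Bool) → ι → Bool} (hf : Computes s f) (e : ι' → ι) :
    Computes s (fun x i => f x (e i)) :=
  hf.comp (wire e)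

/-- Circuits for the single output bits combine to a circuit for the whole output. -/
theorem pi [Fintype ι] {s : ℕ} {f : (κ → Bool) → ι → Bool}
    (h : ∀ i, Computes s (fun x (_ : Unit) => f x i)) : Computes (Fintype.card ι * s) f := by
  classical
  have key : ∀ t : Finset ι, Computes (t.card * s) (fun x (i : t) => f x i) := by
    intro t
    induction t using Finset.induction_on with
    | empty => exact ⟨0, by simp, .nil, fun i => absurd i.2 (Finset.notMem_empty _),
        fun x i => absurd i.2 (Finset.notMem_empty _)⟩
    | insert a t ha ih =>
      refine (((ih.pair (h a)).reindex (fun i : (insert a t : Finset ι) =>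
        if hi : (i : ι) ∈ t then Sum.inl ⟨i, hi⟩ else Sum.inr ())).congr ?_).mono ?_
      · intro x i
        by_cases hi : (i : ι) ∈ t
        · simp [hi]
        · have : (i : ι) = a := (Finset.mem_insert.1 i.2).resolve_right hi
          simp [this, ha]
      · rw [Finset.card_insert_of_notMem ha]; ring_nf; rfl
  exact (key Finset.univ).reindex (fun i => ⟨i, Finset.mem_univ i⟩)

theorem const (b : Bool) : Computes 1 (fun (_ : κ → Bool) (_ : Unit) => b) :=
  (gate (.const b)).congr fun _ _ => rfl

/-- Constant output bits. -/
theorem const_pi [Fintype ι] (g : ι → Bool) : Computes (Fintype.card ι) (fun _ : κ → Bool => g) :=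
  (pi (s := 1) (f := fun _ => g) fun i => const (g i)).mono (mul_one _).le

theorem not {s : ℕ} {f : (κ → Bool) → Unit → Bool} (hf : Computes s f) :
    Computes (s + 1) (fun x i => !(f x i)) :=
  (hf.comp (gate (.not ()))).congr fun _ _ => rfl

/-- Conjunction of a finite set of input bits. -/
theorem forall_mem {α : Type} (t : Finset α) (w : α → κ) :
    Computes (t.card + 1) (fun (x : κ → Bool) (_ : Unit) => decide (∀ a ∈ t, x (w a) = true)) := by
  classical
  induction t using Finset.induction_on with
  | empty => exact (const true).congr fun _ _ => by simp
  | insert a t ha ih =>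
    rw [Finset.card_insert_of_notMem ha]
    refine ((ih.pair (wire (fun _ : Unit => w a))).comp
      (gate (.and (.inl ()) (.inr ())))).congr fun x _ => ?_
    simp [Gate.eval, Bool.and_comm]

/-- Disjunction of a finite set of input bits. -/
theorem exists_mem {α : Type} (t : Finset α) (w : α → κ) :
    Computes (t.card + 1) (fun (x : κ → Bool) (_ : Unit) => decide (∃ a ∈ t, x (w a) = true)) := by
  classical
  induction t using Finset.induction_on with
  | empty => exact (const false).congr fun _ _ => by simp
  | insert a t ha ih =>
    rw [Finset.card_insert_of_notMem ha]
    refine ((ih.pair (wire (fun _ : Unit => w a))).comp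
      (gate (.or (.inl ()) (.inr ())))).congr fun x _ => ?_
    simp [Gate.eval, Bool.or_comm]

/-- Case distinction between two fixed bits. -/
theorem ite {s : ℕ} {f : (κ → Bool) → Unit → Bool} (hf : Computes s f) (a b : Bool) :
    Computes (s + 1) (fun x i => if f x i then a else b) := by
  cases a <;> cases b
  · exact ((const false).mono (by omega)).congr fun x i => by simp
  · exact hf.not.congr fun x i => by cases f x i <;> rfl
  · exact (hf.mono (by omega)).congr fun x i => by cases f x i <;> rfl
  · exact ((const true).mono (by omega)).congr fun x i => by simp

theorem circuit (C : Circuit κ) : Computes C.size (fun x (_ : Unit) => C.eval x) :=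
  ⟨C.size, le_rfl, C.gates, fun _ => C.out, fun _ _ => rfl⟩

theorem exists_circuit {s : ℕ} {f : (κ → Bool) → Unit → Bool} (hf : Computes s f) :
    ∃ C : Circuit κ, C.size ≤ s ∧ ∀ x, C.eval x = f x () := by
  obtain ⟨r, hr, L, w, h⟩ := hf
  exact ⟨⟨r, L, w ()⟩, hr, fun x => h x ()⟩

end Computes

/-! ### Differences of `|s| ^ p` -/

/-- This is the Newton series of `|s|^p` based at `-1`, cut off at order `j`. Starting at `-1`
rather than `0` lets the polynomial see one value to the left of the kink. The case `q = 0` is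
needed for `j = 0`. -/
theorem abs_rpow_eq_poly_eval {p : ℝ} {j : ℕ} (h : ∀ n : ℕ, (fwdDiff (1 : ℝ))^[j] (fun s => |s| ^ p) (-1 + n) = 0) :
    ∃ q : Polynomial ℝ, (q = 0 ∨ q.natDegree < j) ∧ ∀ n : ℕ, |(-1 + n : ℝ)| ^ p = q.eval (n : ℝ) := by
  set f : ℝ → ℝ := fun s => |s| ^ p with hf
  have hzero : ∀ i, j ≤ i → (fwdDiff (1 : ℝ))^[i] f (-1) = 0 := by
    intro i hi
    obtain ⟨i, rfl⟩ := Nat.exists_eq_add_of_le' hi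
    rw [Function.iterate_add_apply, fwdDiff_iter_eq_sum_shift]
    exact Finset.sum_eq_zero fun m _ => by simp [h m]
  refine ⟨∑ i ∈ Finset.range j, Polynomial.C ((fwdDiff (1 : ℝ))^[i] f (-1) / i.factorial) *
    descPochhammer ℝ i, ?_, fun n => ?_⟩
  · rcases Nat.eq_zero_or_pos j with rfl | hj
    · simp
    · right
      refine lt_of_le_of_lt (Polynomial.natDegree_sum_le_of_forall_le (n := j - 1) _ _ fun i hi => ?_)
        (by omega)
      refine (Polynomial.natDegree_C_mul_le _ _).trans ?_
      rw [descPochhammer_natDegree]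
      have := Finset.mem_range.1 hi
      omega
  · have key : f (-1 + n) = ∑ i ∈ Finset.range (n + 1 + j), n.choose i * (fwdDiff (1 : ℝ))^[i] f (-1) := by
      have := shift_eq_sum_fwdDiff_iter (1 : ℝ) f n (-1)
      rw [nsmul_one] at this
      rw [this]
      simp only [nsmul_eq_mul]
      refine Finset.sum_subset (by intro; simp; omega) fun i _ hi => ?_
      rw [Nat.choose_eq_zero_of_lt (by simpa using hi)]
      simp
    rw [show |(-1 + n : ℝ)| ^ p = f (-1 + n) from rfl, key, Polynomial.eval_finsetSum]
    symm
    refine Finset.sum_subset_zero_on_sdiff (by intro; simp; omega) (fun i hi => ?_) fun i _ => ?_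
    · rw [hzero i (by simp at hi; omega), mul_zero]
    · rw [Polynomial.eval_mul, Polynomial.eval_C, descPochhammer_eval_eq_descFactorial,
        Nat.descFactorial_eq_factorial_mul_choose]
      have := Nat.factorial_ne_zero i
      push_cast
      field_simp

/-- Shifting the Newton polynomial gives `Q` with `Q(n) = n^p` on the naturals and `Q(-1) = 1`.
Growth at infinity forces `p = deg Q`, hence `Q = X^p`, and the value at `-1` excludes odd
exponents. -/
theorem exists_even_of_fwdDiff_eq_zero {p : ℝ} {j : ℕ}
    (h : ∀ s, (fwdDiff (1 : ℝ))^[j] (fun s => |s| ^ p) s = 0) :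
    ∃ m : ℕ, p = m ∧ Even m ∧ m < j := by
  obtain ⟨q, hq, hqe⟩ := abs_rpow_eq_poly_eval fun n => h (-1 + n)
  have hqe' : ∀ n : ℕ, (n : ℝ) ^ p = (q.comp (Polynomial.X + 1)).eval (n : ℝ) := by
    intro n
    have := hqe (n + 1)
    simp only [Polynomial.eval_comp, Polynomial.eval_add, Polynomial.eval_X, Polynomial.eval_one]
    push_cast at this
    rw [← this, show (-1 + ((n : ℝ) + 1)) = n by ring, Nat.abs_cast]
  have hne : q.comp (Polynomial.X + 1) ≠ 0 := by
    intro h0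
    have := hqe' 1
    simp [h0] at this
  have hdeg : (q.comp (Polynomial.X + 1)).natDegree < j := by
    have hq0 : q ≠ 0 := by rintro rfl; simp at hne
    rw [Polynomial.natDegree_comp, show (Polynomial.X + 1 : Polynomial ℝ) = Polynomial.X + Polynomial.C 1 by simp,
      Polynomial.natDegree_X_add_C, mul_one]
    exact hq.resolve_left hq0
  have h1 : (q.comp (Polynomial.X + 1)).eval (-1) = 1 := by
    have := hqe 0
    simpa using this.symm
  set Q := q.comp (Polynomial.X + 1)
  have hlim : Tendsto (fun n : ℕ => (n : ℝ) ^ (p - Q.natDegree)) atTop (nhds Q.leadingCoeff) := by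
    have h2 := (Q.isEquivalent_atTop_lead).comp_tendsto tendsto_natCast_atTop_atTop
    have h3 : Tendsto (fun n : ℕ => Q.eval (n : ℝ) / (n : ℝ) ^ Q.natDegree) atTop
        (nhds Q.leadingCoeff) := by
      have h4 : (fun n : ℕ => Q.eval (n : ℝ) / (n : ℝ) ^ Q.natDegree) ~[atTop]
          fun n : ℕ => Q.leadingCoeff * (n : ℝ) ^ Q.natDegree / (n : ℝ) ^ Q.natDegree :=
        IsEquivalent.div h2 IsEquivalent.refl
      refine h4.symm.tendsto_nhds (tendsto_const_nhds.congr' ?_)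
      filter_upwards [eventually_gt_atTop 0] with n hn
      have : (n : ℝ) ^ Q.natDegree ≠ 0 := by positivity
      field_simp
    refine h3.congr' ?_
    filter_upwards [eventually_gt_atTop 0] with n hn
    rw [← hqe' n, Real.rpow_sub (by positivity), Real.rpow_natCast]
  have hlead : Q.leadingCoeff ≠ 0 := Polynomial.leadingCoeff_ne_zero.2 hne
  -- A nonzero finite limit of `n ^ (p - deg Q)` leaves no exponent but zero.
  have hpm : p = Q.natDegree := by
    rcases lt_trichotomy p Q.natDegree with hlt | heq | hgt
    · have := (tendsto_rpow_neg_atTop (sub_pos.2 hlt)).comp (tendsto_natCast_atTop_atTop (R := ℝ))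
      simp only [neg_sub] at this
      exact absurd (tendsto_nhds_unique hlim this) hlead
    · exact heq
    · have := (tendsto_rpow_atTop (sub_pos.2 hgt)).comp (tendsto_natCast_atTop_atTop (R := ℝ))
      exact absurd hlim (not_tendsto_nhds_of_tendsto_atTop this _)
  refine ⟨Q.natDegree, hpm, ?_, hdeg⟩
  have hQ : Q = Polynomial.X ^ Q.natDegree := by
    refine Polynomial.eq_of_infinite_eval_eq _ _ (Set.Infinite.mono ?_ (Set.infinite_range_of_injective (Nat.cast_injective (R := ℝ))))
    rintro _ ⟨n, rfl⟩
    have := hqe' n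
    rw [hpm, Real.rpow_natCast] at this
    simp [← this]
  rw [hQ, Polynomial.eval_pow, Polynomial.eval_X] at h1
  by_contra hodd
  rw [(Nat.not_even_iff_odd.1 hodd).neg_one_pow] at h1
  norm_num at h1

/-! ### Sums of `p`-th powers of affine forms on the cube -/

/-- An affine form on the cube `{0, 1} ^ k`, whose points are given by their supports. -/
def IsAffine {k : ℕ} (l : Finset (Fin k) → ℝ) : Prop :=
  ∃ (v : Fin k → ℝ) (t : ℝ), ∀ X, l X = ∑ i ∈ X, v i - t

/-- A sum of `p`-th powers of absolute values of affine forms. -/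
def IsLpSum (p : ℝ) {k : ℕ} (F : Finset (Fin k) → ℝ) : Prop :=
  ∃ (ι : Type) (_ : Fintype ι) (l : ι → Finset (Fin k) → ℝ),
    (∀ i, IsAffine (l i)) ∧ ∀ X, F X = ∑ i, |l i X| ^ p

section LpSum

variable {p : ℝ} {k : ℕ}

/-- Taking the symmetric difference with `R` is the reflection `x i ↦ 1 - x i` for `i ∈ R`, an
affine map. -/
theorem IsAffine.symmDiff {l : Finset (Fin k) → ℝ} (hl : IsAffine l) (R : Finset (Fin k)) :
    IsAffine (fun X => l (symmDiff X R)) := by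
  obtain ⟨v, t, h⟩ := hl
  refine ⟨fun i => if i ∈ R then -v i else v i, t - ∑ i ∈ R, v i, fun X => ?_⟩
  have hX : ∀ X : Finset (Fin k), ∑ i ∈ X, v i = ∑ i, if i ∈ X then v i else 0 := fun X => by simp
  have hX' : ∑ i ∈ X, (if i ∈ R then -v i else v i) =
      ∑ i, if i ∈ X then (if i ∈ R then -v i else v i) else 0 := by simp
  beta_reduce
  rw [h, hX', hX, hX R, sub_sub_eq_add_sub, ← Finset.sum_add_distrib]
  congr 1
  refine Finset.sum_congr rfl fun i _ => ?_
  by_cases h1 : i ∈ X <;> by_cases h2 : i ∈ R <;> simp [Finset.mem_symmDiff, h1, h2]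

theorem IsAffine.const_mul {l : Finset (Fin k) → ℝ} (hl : IsAffine l) (c : ℝ) :
    IsAffine (fun X => c * l X) := by
  obtain ⟨v, t, h⟩ := hl
  exact ⟨fun i => c * v i, c * t, fun X => by simp only [h, mul_sub, Finset.mul_sum]⟩

theorem IsAffine.isLpSum {l : Finset (Fin k) → ℝ} (hl : IsAffine l) :
    IsLpSum p (fun X => |l X| ^ p) :=
  ⟨Unit, inferInstance, fun _ => l, fun _ => hl, fun _ => by simp⟩

theorem IsLpSum.zero : IsLpSum p (fun _ : Finset (Fin k) => 0) :=
  ⟨Empty, inferInstance, fun i => i.elim, fun i => i.elim, fun _ => by simp⟩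

theorem IsLpSum.add {F G : Finset (Fin k) → ℝ} (hF : IsLpSum p F) (hG : IsLpSum p G) :
    IsLpSum p (fun X => F X + G X) := by
  obtain ⟨ι, _, l, hl, hF⟩ := hF
  obtain ⟨ι', _, l', hl', hG⟩ := hG
  refine ⟨ι ⊕ ι', inferInstance, Sum.elim l l', ?_, fun X => ?_⟩
  · rintro (i | i)
    exacts [hl i, hl' i]
  · simp [hF, hG]

theorem IsLpSum.sum {α : Type*} (s : Finset α) {F : α → Finset (Fin k) → ℝ}
    (hF : ∀ a ∈ s, IsLpSum p (F a)) : IsLpSum p (fun X => ∑ a ∈ s, F a X) := by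
  classical
  induction s using Finset.induction_on with
  | empty => simpa using IsLpSum.zero
  | insert a s ha ih =>
    simp only [Finset.sum_insert ha]
    exact (hF a (Finset.mem_insert_self a s)).add (ih fun b hb => hF b (Finset.mem_insert_of_mem hb))

theorem IsLpSum.const_mul (hp : 0 < p) {F : Finset (Fin k) → ℝ} (hF : IsLpSum p F) {c : ℝ}
    (hc : 0 ≤ c) : IsLpSum p (fun X => c * F X) := by
  obtain ⟨ι, _, l, hl, hF⟩ := hF
  refine ⟨ι, inferInstance, fun i X => c ^ p⁻¹ * l i X, fun i => (hl i).const_mul _, fun X => ?_⟩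
  have hc' : 0 ≤ c ^ p⁻¹ := by positivity
  simp_rw [hF, Finset.mul_sum, abs_mul, abs_of_nonneg hc', Real.mul_rpow hc' (abs_nonneg _),
    Real.rpow_inv_rpow hc hp.ne']

theorem IsLpSum.const (hp : 0 < p) {c : ℝ} (hc : 0 ≤ c) : IsLpSum p (fun _ : Finset (Fin k) => c) := by
  have h : IsAffine (fun _ : Finset (Fin k) => (1 : ℝ)) := ⟨0, -1, fun X => by simp⟩
  simpa using (h.isLpSum (p := p)).const_mul hp hc

theorem IsLpSum.nonneg {F : Finset (Fin k) → ℝ} (hF : IsLpSum p F) (X : Finset (Fin k)) : 0 ≤ F X := by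
  obtain ⟨ι, _, l, -, hF⟩ := hF
  rw [hF]
  positivity

theorem IsLpSum.symmDiff {F : Finset (Fin k) → ℝ} (hF : IsLpSum p F) (R : Finset (Fin k)) :
    IsLpSum p (fun X => F (symmDiff X R)) := by
  obtain ⟨ι, _, l, hl, hF⟩ := hF
  exact ⟨ι, inferInstance, fun i X => l i (_root_.symmDiff X R), fun i => (hl i).symmDiff R, fun X => hF _⟩

/-- The nontrivial reflections of `F` add up to the total of `F` minus `F` itself. This realises
`-F` up to a constant, although sums of `p`-th powers are nonnegative. -/
theorem IsLpSum.sum_sub {F : Finset (Fin k) → ℝ} (hF : IsLpSum p F) :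
    IsLpSum p (fun X => ∑ Y, F Y - F X) := by
  have h := IsLpSum.sum (Finset.univ.erase (∅ : Finset (Fin k))) fun R _ => hF.symmDiff R
  convert h using 2 with X
  rw [Finset.sum_erase_eq_sub (Finset.mem_univ _)]
  have hs : ∑ Y, F Y = ∑ R, F (_root_.symmDiff X R) :=
    (Fintype.sum_bijective (fun R => _root_.symmDiff X R)
      (Function.Involutive.bijective fun R => symmDiff_symmDiff_cancel_left X R) _ _ fun _ => rfl).symm
  rw [hs]
  congr 2
  exact (symmDiff_bot X).symm

/-- The functions on the cube that become sums of `p`-th powers when a constant is added. -/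
def lpSpan (hp : 0 < p) (k : ℕ) : Submodule ℝ (Finset (Fin k) → ℝ) where
  carrier := {F | ∃ K : ℝ, 0 ≤ K ∧ IsLpSum p (fun X => F X + K)}
  zero_mem' := ⟨0, le_rfl, by simpa using IsLpSum.zero⟩
  add_mem' := by
    rintro F G ⟨K, hK, hF⟩ ⟨K', hK', hG⟩
    refine ⟨K + K', add_nonneg hK hK', ?_⟩
    convert hF.add hG using 2 with X
    simp only [Pi.add_apply]
    ring
  smul_mem' := by
    rintro c F ⟨K, hK, hF⟩
    rcases le_total 0 c with hc | hc
    · refine ⟨c * K, mul_nonneg hc hK, ?_⟩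
      convert hF.const_mul hp hc using 2 with X
      simp only [Pi.smul_apply, smul_eq_mul]
      ring
    -- Adding `K` back to the complementary sum cancels the shift inside `F X + K`, so only the
    -- total remains as the constant.
    · refine ⟨-c * ∑ Y, (F Y + K), mul_nonneg (by linarith)
        (Finset.sum_nonneg fun Y _ => hF.nonneg Y), ?_⟩
      convert (hF.sum_sub.add (IsLpSum.const hp hK)).const_mul hp (neg_nonneg.2 hc) using 2 with X
      simp only [Pi.smul_apply, smul_eq_mul]
      ring

/-- The function `x ↦ ∏ i ∈ S, x i` on the cube. -/
def cubeMonomial {k : ℕ} (S : Finset (Fin k)) : Finset (Fin k) → ℝ := fun X => if S ⊆ X then 1 else 0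

/-- This is Newton's forward difference formula, with the binomial coefficients read as numbers of
subsets of `X ∩ S`. -/
theorem abs_rpow_eq_sum_cubeMonomial (f : ℝ → ℝ) (s : ℝ) (S X : Finset (Fin k)) :
    f (s + (X ∩ S).card) = ∑ T ∈ S.powerset, (fwdDiff (1 : ℝ))^[T.card] f s * cubeMonomial T X := by
  have h1 : ∑ T ∈ S.powerset, (fwdDiff (1 : ℝ))^[T.card] f s * cubeMonomial T X =
      ∑ T ∈ (X ∩ S).powerset, (fwdDiff (1 : ℝ))^[T.card] f s := by
    simp only [cubeMonomial, mul_ite, mul_one, mul_zero]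
    rw [← Finset.sum_filter]
    congr 1
    ext T
    rw [Finset.mem_filter, Finset.mem_powerset, Finset.mem_powerset, Finset.subset_inter_iff, and_comm]
  rw [h1, Finset.sum_powerset_apply_card (fun i => (fwdDiff (1 : ℝ))^[i] f s),
    ← shift_eq_sum_fwdDiff_iter, nsmul_one]

/-- The system is triangular: `|s + (X ∩ S).card|^p` expands into monomials of subsets of `S`, and
`s` can be chosen so that `S` itself has a nonzero coefficient. Smaller subsets are covered by
induction. -/
theorem cubeMonomial_mem_lpSpan (hp : 0 < p) (hpk : ∀ m : ℕ, Even m → p = m → k ≤ m)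
    (S : Finset (Fin k)) : cubeMonomial S ∈ lpSpan hp k := by
  induction S using Finset.strongInduction with
  | H S ih =>
    obtain ⟨s, hs⟩ : ∃ s, (fwdDiff (1 : ℝ))^[S.card] (fun s => |s| ^ p) s ≠ 0 := by
      by_contra! h
      obtain ⟨m, h1, h2, h3⟩ := exists_even_of_fwdDiff_eq_zero h
      have := hpk m h2 h1
      have := S.card_le_univ
      simp at this
      omega
    set c := fun i => (fwdDiff (1 : ℝ))^[i] (fun s => |s| ^ p) s
    have hmem : (fun X : Finset (Fin k) => |s + (X ∩ S).card| ^ p) ∈ lpSpan hp k := by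
      refine ⟨0, le_rfl, ?_⟩
      simp only [add_zero]
      refine IsAffine.isLpSum ⟨fun i => if i ∈ S then 1 else 0, -s, fun X => ?_⟩
      rw [← Finset.sum_filter, Finset.filter_mem_eq_inter]
      simp [add_comm]
    have heq : cubeMonomial S = (c S.card)⁻¹ • ((fun X : Finset (Fin k) => |s + (X ∩ S).card| ^ p) -
        ∑ T ∈ S.ssubsets, c T.card • cubeMonomial T) := by
      rw [eq_inv_smul_iff₀ hs, eq_sub_iff_add_eq]
      funext X
      rw [abs_rpow_eq_sum_cubeMonomial (fun s => |s| ^ p), Finset.ssubsets,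
        ← Finset.add_sum_erase _ _ (Finset.mem_powerset_self S)]
      simp [c]
    rw [heq]
    exact Submodule.smul_mem _ _ (Submodule.sub_mem _ hmem (Submodule.sum_mem _ fun T hT =>
      Submodule.smul_mem _ _ (ih T (Finset.mem_ssubsets.1 hT))))

theorem exists_isLpSum_indicator (hp : 0 < p) (hpk : ∀ m : ℕ, Even m → p = m → k ≤ m) :
    ∃ δ : ℝ, 0 < δ ∧ IsLpSum p (fun X : Finset (Fin k) => if X = ∅ then 1 + δ else 1) := by
  have hmem : (fun X : Finset (Fin k) => if X = ∅ then (1 : ℝ) else 0) ∈ lpSpan hp k := by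
    have : (fun X : Finset (Fin k) => if X = ∅ then (1 : ℝ) else 0) =
        ∑ S, (-1 : ℝ) ^ S.card • cubeMonomial S := by
      funext X
      have h := Finset.sum_powerset_neg_one_pow_card (x := X)
      have h' := congrArg (Int.cast : ℤ → ℝ) h
      push_cast at h'
      rw [← h', Finset.sum_apply]
      simp only [Pi.smul_apply, cubeMonomial, smul_eq_mul, mul_ite, mul_one, mul_zero]
      rw [← Finset.sum_filter]
      congr 1
      ext T
      simp
    rw [this]
    exact Submodule.sum_mem _ fun S _ => Submodule.smul_mem _ _ (cubeMonomial_mem_lpSpan hp hpk S)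
  obtain ⟨K, hK, h⟩ := hmem
  have hK' : 0 < K + 1 := by linarith
  -- Since `K` may vanish, 1 is added to it before dividing, which makes the value off the origin
  -- exactly 1.
  refine ⟨(K + 1)⁻¹, by positivity, ?_⟩
  convert (h.add (IsLpSum.const hp zero_le_one)).const_mul hp (inv_nonneg.2 hK'.le) using 2 with X
  by_cases hX : X = ∅
  · simp only [hX, if_true]
    field_simp
    ring
  · simp only [hX, if_false]
    field_simp
    ring

end LpSum

/-! ### Existence of isolating parallelepipeds -/

theorem lpNorm_nonneg (p : ENNReal) [Fact (1 ≤ p)] {d : ℕ} (v : Fin d → ℝ) : 0 ≤ lpNorm p v :=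
  norm_nonneg _

theorem lpNorm_rpow {p : ℝ} (hp : 1 ≤ p) {d : ℕ} (v : Fin d → ℝ) :
    lpNorm (ENNReal.ofReal p) v ^ p = ∑ i, |v i| ^ p := by
  have hp0 : 0 < p := by linarith
  have ht : (ENNReal.ofReal p).toReal = p := ENNReal.toReal_ofReal hp0.le
  rw [lpNorm, PiLp.norm_eq_sum (by rwa [ht]), ht, one_div, Real.rpow_inv_rpow (by positivity) hp0.ne']
  rfl

theorem exists_isIsolating {p : ℝ} (hp : 1 ≤ p) {k : ℕ} (hpk : ∀ m : ℕ, Even m → p = m → k ≤ m) :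
    ∃ (d : ℕ) (V : Matrix (Fin d) (Fin k) ℝ) (t : Fin d → ℝ),
      IsIsolating (ENNReal.ofReal p) V t := by
  have : Fact (1 ≤ ENNReal.ofReal p) := ⟨by simpa using hp⟩
  have hp0 : 0 < p := by linarith
  obtain ⟨δ, hδ, ι, _, l, hl, hF⟩ := exists_isLpSum_indicator (k := k) hp0 hpk
  choose v t h using hl
  let e := Fintype.equivFin ι
  have key : ∀ X : Finset (Fin k),
      lpNorm (ENNReal.ofReal p) (Matrix.mulVec (fun i j => v (e.symm i) j)
        (fun j => if j ∈ X then 1 else 0) - fun i => t (e.symm i)) ^ p = if X = ∅ then 1 + δ else 1 := by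
    intro X
    rw [lpNorm_rpow hp]
    refine Eq.trans ?_ (hF X).symm
    refine Fintype.sum_equiv e.symm _ _ fun i => ?_
    rw [h]
    simp [Matrix.mulVec, dotProduct]
  refine ⟨Fintype.card ι, fun i j => v (e.symm i) j, fun i => t (e.symm i), fun x hx hx0 => ?_, ?_⟩
  · have hX : x = fun j => if j ∈ Finset.univ.filter (fun i => x i = 1) then 1 else 0 := by
      funext j
      rcases hx j with h | h <;> simp [h]
    have hne : Finset.univ.filter (fun i => x i = 1) ≠ ∅ := by
      intro h0
      rw [h0] at hX
      exact hx0 (by rw [hX]; funext j; simp)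
    have hk := key (Finset.univ.filter (fun i => x i = 1))
    rw [← hX, if_neg hne] at hk
    refine (Real.rpow_left_inj (lpNorm_nonneg _ _) zero_le_one hp0.ne').1 ?_
    rw [hk, Real.one_rpow]
  · have hk := key ∅
    rw [if_pos rfl, lpNorm_rpow hp] at hk
    refine (Real.rpow_lt_rpow_iff zero_le_one (lpNorm_nonneg _ _) hp0).1 ?_
    rw [lpNorm_rpow hp, Real.one_rpow]
    simp [Matrix.mulVec, dotProduct] at hk
    rw [hk]
    linarith

/-! ### On-off isolating parallelepipeds -/

theorem mulVec_snoc {d k : ℕ} (V : Matrix (Fin d) (Fin k) ℝ) (u : Fin d → ℝ) (x : Fin (k + 1) → ℝ) :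
    Matrix.mulVec (fun i => (Fin.snoc (V i) (u i) : Fin (k + 1) → ℝ)) x =
      V.mulVec (Fin.init x) + x (Fin.last k) • u := by
  funext i
  simp [Matrix.mulVec, dotProduct, Fin.sum_univ_castSucc, Fin.init, mul_comm]

/-- Setting the new coordinate to 1 translates the target from `tOn` to `tOff`, so the two faces of
the larger cube are the on and off cases. -/
theorem IsOnOffIsolating.isIsolating_snoc {p : ENNReal} {d k : ℕ} {V : Matrix (Fin d) (Fin k) ℝ}
    {tOn tOff : Fin d → ℝ} (h : IsOnOffIsolating p V tOn tOff) :
    IsIsolating p (fun i => (Fin.snoc (V i) (tOn i - tOff i) : Fin (k + 1) → ℝ)) tOn := by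
  obtain ⟨h1, h2, h3⟩ := h
  refine ⟨fun x hx hx0 => ?_, h2⟩
  rw [mulVec_snoc V (fun i => tOn i - tOff i)]
  have hi : IsZeroOne (Fin.init x) := fun i => hx i.castSucc
  rcases hx (Fin.last k) with hl | hl
  · rw [hl, zero_smul, add_zero]
    refine h1 _ hi fun h0 => hx0 ?_
    rw [← Fin.snoc_init_self x, h0, hl]
    funext i
    refine Fin.lastCases ?_ (fun i => ?_) i <;> simp
  · refine Eq.trans ?_ (h3 _ hi)
    rw [hl]
    congr 1
    funext i
    simp
    ring

/-- Points with last coordinate 1 are never the origin, so that face has no exceptional vertex and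
serves as the off case. -/
theorem IsIsolating.isOnOffIsolating {p : ENNReal} {d k : ℕ} {V : Matrix (Fin d) (Fin (k + 1)) ℝ}
    {t : Fin d → ℝ} (h : IsIsolating p V t) :
    IsOnOffIsolating p (fun i (j : Fin k) => V i j.castSucc) t (fun i => t i - V i (Fin.last k)) := by
  obtain ⟨h1, h2⟩ := h
  have hV : ∀ (x : Fin k → ℝ) (c : ℝ), V.mulVec (Fin.snoc x c : Fin (k + 1) → ℝ) =
      Matrix.mulVec (fun i (j : Fin k) => V i j.castSucc) x + c • fun i => V i (Fin.last k) := by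
    intro x c
    funext i
    simp [Matrix.mulVec, dotProduct, Fin.sum_univ_castSucc, mul_comm]
  have h01 : ∀ (x : Fin k → ℝ) (c : ℝ), IsZeroOne x → (c = 0 ∨ c = 1) →
      IsZeroOne (Fin.snoc x c : Fin (k + 1) → ℝ) := by
    intro x c hx hc i
    refine Fin.lastCases ?_ (fun i => ?_) i
    · simpa using hc
    · simpa using hx i
  refine ⟨fun x hx hx0 => ?_, h2, fun x hx => ?_⟩
  · rw [← h1 _ (h01 x 0 hx (Or.inl rfl)), hV]
    · simp
    · intro h0
      refine hx0 (funext fun i => ?_)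
      simpa using congrFun h0 i.castSucc
  · rw [← h1 _ (h01 x 1 hx (Or.inr rfl)), hV]
    · congr 1
      funext i
      simp
      ring
    · intro h0
      simpa using congrFun h0 (Fin.last k)

theorem IsComputableReal.sub {x y : ℝ} (hx : IsComputableReal x) (hy : IsComputableReal y) :
    IsComputableReal (x - y) := by
  obtain ⟨a, b, c, ha, hb, hc, h⟩ := hx
  obtain ⟨a', b', c', ha', hb', hc', h'⟩ := hy
  have add : ∀ {f g : ℕ → ℕ}, Computable f → Computable g → Computable fun n => f n + g n :=
    fun hf hg => (Primrec.nat_add.to_comp).comp hf hg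
  have mul : ∀ {f g : ℕ → ℕ}, Computable f → Computable g → Computable fun n => f n * g n :=
    fun hf hg => (Primrec.nat_mul.to_comp).comp hf hg
  have hs : Computable fun n : ℕ => n + 1 := Primrec.succ.to_comp
  have hs' : ∀ {f : ℕ → ℕ}, Computable f → Computable fun n => f (n + 1) := fun hf => hf.comp hs
  have one : ∀ {f : ℕ → ℕ}, Computable f → Computable fun n => f n + 1 := fun hf => hs.comp hf
  -- Precision `n + 1` in both arguments makes the errors add up to `2 ^ (-n)`. The third function
  -- is `(c + 1) (c' + 1) - 1` without subtraction.
  refine ⟨fun n => a (n + 1) * (c' (n + 1) + 1) + b' (n + 1) * (c (n + 1) + 1),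
    fun n => b (n + 1) * (c' (n + 1) + 1) + a' (n + 1) * (c (n + 1) + 1),
    fun n => c (n + 1) * c' (n + 1) + (c (n + 1) + c' (n + 1)),
    add (mul (hs' ha) (one (hs' hc'))) (mul (hs' hb') (one (hs' hc))),
    add (mul (hs' hb) (one (hs' hc'))) (mul (hs' ha') (one (hs' hc))),
    add (mul (hs' hc) (hs' hc')) (add (hs' hc) (hs' hc')), fun n => ?_⟩
  have h1 := h (n + 1)
  have h2 := h' (n + 1)
  have e : (((a (n + 1) * (c' (n + 1) + 1) + b' (n + 1) * (c (n + 1) + 1) : ℕ) : ℝ) -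
      ((b (n + 1) * (c' (n + 1) + 1) + a' (n + 1) * (c (n + 1) + 1) : ℕ) : ℝ)) /
      (((c (n + 1) * c' (n + 1) + (c (n + 1) + c' (n + 1)) : ℕ) : ℝ) + 1) =
      ((a (n + 1) : ℝ) - b (n + 1)) / (c (n + 1) + 1) - ((a' (n + 1) : ℝ) - b' (n + 1)) / (c' (n + 1) + 1) := by
    have : (c (n + 1) : ℝ) + 1 ≠ 0 := by positivity
    have : (c' (n + 1) : ℝ) + 1 ≠ 0 := by positivity
    have : ((c (n + 1) : ℝ) * c' (n + 1) + (c (n + 1) + c' (n + 1)) + 1) ≠ 0 := by positivity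
    push_cast
    field_simp
    ring
  rw [e]
  have e2 : (1 : ℝ) / 2 ^ n = 1 / 2 ^ (n + 1) + 1 / 2 ^ (n + 1) := by rw [pow_succ]; field_simp; norm_num
  rw [e2]
  refine le_trans (le_of_eq ?_) ((abs_sub _ _).trans (add_le_add h1 h2))
  congr 1
  ring

theorem exists_isOnOffIsolating {p : ℝ} (hp : 1 ≤ p) {k : ℕ}
    (hpk : ∀ m : ℕ, Even m → p = m → k + 1 ≤ m) :
    ∃ (d : ℕ) (V : Matrix (Fin d) (Fin k) ℝ) (tOn tOff : Fin d → ℝ),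
      IsOnOffIsolating (ENNReal.ofReal p) V tOn tOff := by
  obtain ⟨d, V, t, h⟩ := exists_isIsolating hp hpk
  exact ⟨d, _, _, _, h.isOnOffIsolating⟩

/-! ### Polynomially bounded functions of the instance size -/

/-- The function `g` is at most polynomial in the instance size. -/
def PolyBounded (g : ℕ → ℕ → ℕ) : Prop := ∃ c : ℕ, ∀ n m, g n m ≤ (n + m + 2) ^ c

namespace PolyBounded

variable {f g : ℕ → ℕ → ℕ}

theorem mono (hg : PolyBounded g) (h : ∀ n m, f n m ≤ g n m) : PolyBounded f := by
  obtain ⟨c, hc⟩ := hg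
  exact ⟨c, fun n m => (h n m).trans (hc n m)⟩

theorem const (a : ℕ) : PolyBounded fun _ _ => a :=
  ⟨a, fun n m => (Nat.lt_two_pow_self).le.trans (Nat.pow_le_pow_left (by omega) a)⟩

theorem left : PolyBounded fun n _ => n := ⟨1, fun n m => by simp; omega⟩

theorem right : PolyBounded fun _ m => m := ⟨1, fun n m => by simp; omega⟩

theorem mul (hf : PolyBounded f) (hg : PolyBounded g) : PolyBounded fun n m => f n m * g n m := by
  obtain ⟨c, hc⟩ := hf
  obtain ⟨c', hc'⟩ := hg
  exact ⟨c + c', fun n m => by rw [pow_add]; exact Nat.mul_le_mul (hc n m) (hc' n m)⟩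

theorem one_add (hg : PolyBounded g) : PolyBounded fun n m => 1 + g n m := by
  obtain ⟨c, hc⟩ := hg
  refine ⟨c + 1, fun n m => ?_⟩
  have h1 := hc n m
  have h2 : 1 ≤ (n + m + 2) ^ c := Nat.one_le_pow _ _ (by omega)
  rw [pow_succ]
  nlinarith

theorem add (hf : PolyBounded f) (hg : PolyBounded g) : PolyBounded fun n m => f n m + g n m :=
  (hf.one_add.mul hg.one_add).mono fun n m => by nlinarith [Nat.zero_le (f n m * g n m)]

theorem pow (hf : PolyBounded f) (a : ℕ) : PolyBounded fun n m => f n m ^ a := by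
  obtain ⟨c, hc⟩ := hf
  exact ⟨c * a, fun n m => by rw [pow_mul]; exact Nat.pow_le_pow_left (hc n m) a⟩

end PolyBounded

/-! ### Distances to lattices and encodings of integers -/

theorem lpDist_le {p : ENNReal} [Fact (1 ≤ p)] {d : ℕ} {L : Set (Fin d → ℝ)} {x t : Fin d → ℝ}
    (hx : x ∈ L) : lpDist p L t ≤ lpNorm p (x - t) :=
  csInf_le ⟨0, by rintro _ ⟨y, -, rfl⟩; exact lpNorm_nonneg p _⟩ ⟨x, hx, rfl⟩

theorem le_lpDist {p : ENNReal} {d : ℕ} {L : Set (Fin d → ℝ)} {t : Fin d → ℝ} {r : ℝ}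
    (hL : L.Nonempty) (h : ∀ x ∈ L, r ≤ lpNorm p (x - t)) : r ≤ lpDist p L t :=
  le_csInf (hL.image _) (by rintro _ ⟨y, hy, rfl⟩; exact h y hy)

/-- Using the magnitude itself as the bit length is wasteful, but all numbers in the reduction are
polynomially bounded. -/
theorem fitsIn_intCast {b : ℕ} {z : ℤ} (hb : 1 ≤ b) (hz : |z| ≤ b) : FitsIn b (z : ℚ) := by
  have h := Nat.lt_two_pow_self (n := b)
  refine ⟨?_, ?_⟩
  · rw [Rat.num_intCast]
    rw [Int.abs_eq_natAbs] at hz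
    exact lt_of_le_of_lt (by exact_mod_cast hz) h
  · rw [Rat.den_intCast]
    exact lt_of_le_of_lt hb h

/-! ### The lattice of the reduction -/

/-- The coordinates of the lattice: one for each variable, and one block for each pair of a clause
position and a potential clause. -/
abbrev Row (k n m e : ℕ) : Type := Fin n ⊕ (Fin m × (Fin k → Literal n) × Fin e)

section Gadget

variable {k n m e : ℕ}

/-- The value of a literal at the point `z`. -/
def litValue (z : Fin n → ℤ) (l : Literal n) : ℤ := if l.2 then z l.1 else 1 - z l.1

/-- The entries of the basis. -/
def gadgetBasis (a : ℤ) (V : Fin e → Fin k → ℤ) : Row k n m e → Fin n → ℤ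
  | .inl i, j => if i = j then 2 * a else 0
  | .inr (_, c, l), j => ∑ s, if (c s).1 = j then (if (c s).2 then V l s else -V l s) else 0

/-- The entries of the target; `o i c` says whether the block of the pair `(i, c)` is on. -/
def gadgetTarget (a : ℤ) (V : Fin e → Fin k → ℤ) (tOn tOff : Fin e → ℤ)
    (o : Fin m → (Fin k → Literal n) → Bool) : Row k n m e → ℤ
  | .inl _ => a
  | .inr (i, c, l) => (if o i c then tOn l else tOff l) - ∑ s, if (c s).2 then 0 else V l s

/-- The difference of a lattice vector and the target for the formula `Φ`. -/
def gadgetVec (a : ℤ) (V : Fin e → Fin k → ℤ) (tOn tOff : Fin e → ℤ) (Φ : Formula k n m)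
    (z : Fin n → ℤ) : Row k n m e → ℤ
  | .inl i => a * (2 * z i - 1)
  | .inr (i, c, l) => ∑ s, V l s * litValue z (c s) - if Φ i = c then tOn l else tOff l

/-- A negated literal has value `1 - z`, hence the sign in the basis; its constant part is moved to
the target. -/
theorem sum_gadgetBasis_mul_sub (a : ℤ) (V : Fin e → Fin k → ℤ) (tOn tOff : Fin e → ℤ)
    (Φ : Formula k n m) (z : Fin n → ℤ) (ρ : Row k n m e) :
    ∑ j, gadgetBasis a V ρ j * z j - gadgetTarget a V tOn tOff (fun i c => decide (Φ i = c)) ρ =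
      gadgetVec a V tOn tOff Φ z ρ := by
  rcases ρ with i | ⟨i, c, l⟩
  · simp only [gadgetBasis, gadgetTarget, gadgetVec, ite_mul, zero_mul, Finset.sum_ite_eq,
      Finset.mem_univ, if_true]
    ring
  · simp only [gadgetBasis, gadgetTarget, gadgetVec, Finset.sum_mul, decide_eq_true_eq]
    rw [Finset.sum_comm, sub_sub_eq_add_sub, sub_left_inj, ← Finset.sum_add_distrib]
    refine Finset.sum_congr rfl fun s _ => ?_
    simp only [litValue, ite_mul, zero_mul, Finset.sum_ite_eq, Finset.mem_univ, if_true]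
    split_ifs <;> ring

theorem abs_gadgetBasis_le {a M : ℤ} {V : Fin e → Fin k → ℤ} (ha : |a| ≤ M) (hV : ∀ l s, |V l s| ≤ M)
    (ρ : Row k n m e) (j : Fin n) : |gadgetBasis a V ρ j| ≤ (k + 2) * M := by
  have hM : 0 ≤ M := (abs_nonneg a).trans ha
  rcases ρ with i | ⟨i, c, l⟩
  · simp only [gadgetBasis]
    split_ifs
    · rw [abs_mul, abs_two]
      nlinarith
    · rw [abs_zero]
      positivity
  · refine (Finset.abs_sum_le_sum_abs _ _).trans ((Finset.sum_le_card_nsmul _ _ M fun s _ => ?_).trans ?_)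
    · split_ifs
      · exact hV l s
      · rw [abs_neg]
        exact hV l s
      · simpa using hM
    · simp
      nlinarith

theorem abs_gadgetTarget_le {a M : ℤ} {V : Fin e → Fin k → ℤ} {tOn tOff : Fin e → ℤ}
    (ha : |a| ≤ M) (hV : ∀ l s, |V l s| ≤ M) (hOn : ∀ l, |tOn l| ≤ M) (hOff : ∀ l, |tOff l| ≤ M)
    (o : Fin m → (Fin k → Literal n) → Bool) (ρ : Row k n m e) :
    |gadgetTarget a V tOn tOff o ρ| ≤ (k + 2) * M := by
  have hM : 0 ≤ M := (abs_nonneg a).trans ha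
  rcases ρ with i | ⟨i, c, l⟩
  · simp only [gadgetTarget]
    nlinarith
  · simp only [gadgetTarget]
    have h1 : |∑ s, if (c s).2 then 0 else V l s| ≤ k * M := by
      refine (Finset.abs_sum_le_sum_abs _ _).trans
        ((Finset.sum_le_card_nsmul _ _ M fun s _ => ?_).trans (by simp))
      split_ifs
      · simpa using hM
      · exact hV l s
    have h2 : |if o i c then tOn l else tOff l| ≤ M := by
      split_ifs
      exacts [hOn l, hOff l]
    refine (abs_sub _ _).trans ?_
    linarith

theorem card_row : Fintype.card (Row k n m e) = n + m * ((n * 2) ^ k * e) := by simp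

/-- The `ℓ_p` norm of the difference of a lattice vector and the target. -/
noncomputable def gadgetNorm (p : ENNReal) (a : ℤ) (V : Fin e → Fin k → ℤ) (tOn tOff : Fin e → ℤ)
    (Φ : Formula k n m) (z : Fin n → ℤ) : ℝ :=
  lpNorm p fun i => (gadgetVec a V tOn tOff Φ z ((Fintype.equivFin (Row k n m e)).symm i) : ℝ)

/-- The basis as a matrix with rational entries. -/
noncomputable def gadgetMatrix (k n m : ℕ) {e : ℕ} (a : ℤ) (V : Fin e → Fin k → ℤ) :
    Matrix (Fin (Fintype.card (Row k n m e))) (Fin n) ℚ :=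
  .of fun i j => (gadgetBasis a V ((Fintype.equivFin (Row k n m e)).symm i) j : ℚ)

theorem gadgetMatrix_isBasis {b : ℕ} {a M : ℤ} {V : Fin e → Fin k → ℤ} (ha0 : 0 < a) (ha : |a| ≤ M)
    (hV : ∀ l s, |V l s| ≤ M) (hb : (k + 2) * M < b) : IsBasis b (gadgetMatrix k n m a V) := by
  have hM : 0 ≤ (k + 2) * M := mul_nonneg (by positivity) ((abs_nonneg a).trans ha)
  refine ⟨?_, fun i j => fitsIn_intCast (by omega) ((abs_gadgetBasis_le ha hV _ j).trans hb.le)⟩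
  rw [Fintype.linearIndependent_iff]
  intro g hg j
  have h := congrFun hg (Fintype.equivFin (Row k n m e) (.inl j))
  simpa [gadgetMatrix, gadgetBasis, ha0.ne'] using h

theorem gadgetMatrix_mulVec_sub (a : ℤ) (V : Fin e → Fin k → ℤ) (tOn tOff : Fin e → ℤ)
    (Φ : Formula k n m) (z : Fin n → ℤ) :
    (((gadgetMatrix k n m a V).map fun q => (q : ℝ)).mulVec fun j => (z j : ℝ)) - (fun i =>
      (((gadgetTarget a V tOn tOff (fun i c => decide (Φ i = c))
        ((Fintype.equivFin (Row k n m e)).symm i) : ℤ) : ℚ) : ℝ)) =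
      fun i => (gadgetVec a V tOn tOff Φ z ((Fintype.equivFin (Row k n m e)).symm i) : ℝ) := by
  funext i
  rw [← sum_gadgetBasis_mul_sub]
  simp [gadgetMatrix, Matrix.mulVec, dotProduct]

end Gadget

/-! ### Query circuits for the instances of the reduction -/

/-- A query algorithm with hardwired preprocessing yields a circuit for the formulas. -/
theorem exists_circuit_answer (A : Algorithm) {k n m e : ℕ} (b : ℕ) (a : ℤ) (V : Fin e → Fin k → ℤ)
    (tOn tOff : Fin e → ℤ) (r : Fin (m + 1) → ℤ) {d' : ℕ} (B : Matrix (Fin d') (Fin n) ℚ)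
    (u : Fin d' → Row k n m e) :
    ∃ C : Circuit (FormulaBits k n m ⊕ Fin (m + 1)),
      C.size ≤ (A.query n d' b (A.preprocess B).length).size + (A.preprocess B).length +
        (d' * (2 * b + 1) * (k + 2) + (2 * b + 1) * (m + 2)) ∧
      ∀ Φ W, C.eval (encodeMax Φ W) = A.answer b B
        (fun i => (gadgetTarget a V tOn tOff (fun i c => decide (Φ i = c)) (u i) : ℚ)) (r W : ℚ) := by
  have h1 : Computes ((A.preprocess B).length) (fun (_ : FormulaBits k n m ⊕ Fin (m + 1) → Bool) =>
      (A.preprocess B).get) :=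
    (Computes.const_pi _).mono (by simp)
  have h2 : Computes (d' * (2 * b + 1) * (k + 2))
      (fun (x : FormulaBits k n m ⊕ Fin (m + 1) → Bool) (i : Fin d' × RatBits b) =>
        encodeRat b ((gadgetTarget a V tOn tOff (fun i c => decide (∀ s ∈ Finset.univ,
          x (.inl (i, s, c s)) = true)) (u i.1) : ℤ) : ℚ) i.2) := by
    refine (Computes.pi (s := k + 2) fun i => ?_).mono (by simp; ring_nf; rfl)
    -- Each target bit is fixed, or depends only on whether clause `j` equals `c`: a conjunction of
    -- `k` input bits selecting one of two constants.
    rcases hi : u i.1 with j | ⟨j, c, l⟩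
    · exact ((Computes.const (encodeRat b (a : ℚ) i.2)).congr fun _ _ => rfl).mono (by omega)
    · have h := (Computes.forall_mem (Finset.univ : Finset (Fin k))
        (fun s => (Sum.inl (j, s, c s) : FormulaBits k n m ⊕ Fin (m + 1)))).ite
        (encodeRat b ((tOn l - ∑ s, (if (c s).2 then 0 else V l s) : ℤ) : ℚ) i.2)
        (encodeRat b ((tOff l - ∑ s, (if (c s).2 then 0 else V l s) : ℤ) : ℚ) i.2)
      refine (h.congr fun x _ => ?_).mono (by simp)
      simp only [gadgetTarget, decide_eq_true_eq]
      split_ifs <;> rfl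
  have h3 : Computes ((2 * b + 1) * (m + 2))
      (fun (x : FormulaBits k n m ⊕ Fin (m + 1) → Bool) (i : RatBits b) =>
        decide (∃ w ∈ Finset.univ.filter (fun w => encodeRat b (r w : ℚ) i = true),
          x (.inr w) = true)) := by
    refine (Computes.pi (s := m + 2) fun i => ?_).mono (by simp; ring_nf; rfl)
    -- The threshold is one-hot encoded, so a bit of the radius is the disjunction of the thresholds
    -- for which it is set.
    refine ((Computes.exists_mem (Finset.univ.filter fun w => encodeRat b (r w : ℚ) i = true)
      Sum.inr).congr fun _ _ => decide_eq_decide.2 Iff.rfl).mono ?_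
    exact Nat.succ_le_succ ((Finset.card_le_univ _).trans (Fintype.card_fin _).le)
  obtain ⟨C, hC, hC'⟩ := ((h1.pair (h2.pair h3)).comp
    (Computes.circuit (A.query n d' b (A.preprocess B).length))).exists_circuit
  refine ⟨C, hC.trans (by omega), fun Φ W => ?_⟩
  rw [hC', Algorithm.answer]
  congr 2
  funext i
  have h : (fun (i : Fin m) (c : Fin k → Literal n) => decide (∀ s ∈ Finset.univ,
      encodeMax Φ W (.inl (i, s, c s)) = true)) = fun i c => decide (Φ i = c) := by
    funext i c
    simp [encodeMax, Formula.encode, funext_iff]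
  rcases i with i | i
  · simp only [Sum.elim_inl, encodeQuery, h]
  · simp [encodeMax, encodeQuery]

/-- If lattices of the form above separate the instances with property `P` from the other ones, then
an algorithm for `γ`-approximate `CVPP_p` yields a family of circuits that decides `P`. -/
theorem exists_maxSatFamily {p : ENNReal} [Fact (1 ≤ p)] {γ : ℝ} {A : Algorithm} (hA : A.Solves p γ)
    {T : ℕ → ℝ} (hT : ∀ n, 1 ≤ T n) (hrun : A.RunsIn T) {k e : ℕ} {M : ℕ → ℕ → ℕ}
    (hM : PolyBounded M) (a : ℕ → ℕ → ℤ) (V : ℕ → ℕ → Fin e → Fin k → ℤ)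
    (tOn tOff : ℕ → ℕ → Fin e → ℤ) (r : ℕ → ∀ m : ℕ, Fin (m + 1) → ℤ)
    (ha0 : ∀ n m, 0 < a n m) (ha : ∀ n m, |a n m| ≤ M n m) (hV : ∀ n m l s, |V n m l s| ≤ M n m)
    (hOn : ∀ n m l, |tOn n m l| ≤ M n m) (hOff : ∀ n m l, |tOff n m l| ≤ M n m)
    (hr0 : ∀ n m W, 0 < r n m W) (hr : ∀ n m W, |r n m W| ≤ M n m)
    (P : ∀ n m : ℕ, Formula k n m → Fin (m + 1) → Prop)
    (hyes : ∀ n m Φ W, P n m Φ W → ∃ z,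
      gadgetNorm p (a n m) (V n m) (tOn n m) (tOff n m) Φ z ≤ r n m W)
    (hno : ∀ n m Φ W, ¬ P n m Φ W → ∃ r' : ℝ, γ * r n m W < r' ∧ ∀ z,
      r' ≤ gadgetNorm p (a n m) (V n m) (tOn n m) (tOff n m) Φ z) :
    ∃ C : MaxSatFamily k, C.HasSize T ∧
      ∀ n m Φ W, (C n m).eval (encodeMax Φ W) = true ↔ P n m Φ W := by
  set b : ℕ → ℕ → ℕ := fun n m => (k + 2) * M n m + 1 with hb
  have hbM : ∀ n m, ((k + 2) * (M n m : ℤ) : ℤ) < b n m := fun n m => by simp [hb]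
  have hb1 : ∀ n m, 1 ≤ b n m := fun n m => by simp [hb]
  choose C hC hCe using fun n m => exists_circuit_answer A (b n m) (a n m) (V n m) (tOn n m)
    (tOff n m) (r n m) (gadgetMatrix k n m (a n m) (V n m)) (Fintype.equivFin (Row k n m e)).symm
  have hbasis : ∀ n m, IsBasis (b n m) (gadgetMatrix k n m (a n m) (V n m)) := fun n m =>
    gadgetMatrix_isBasis (ha0 n m) (ha n m) (hV n m) (hbM n m)
  refine ⟨C, ?_, fun n m Φ W => ?_⟩
  · obtain ⟨c, hc⟩ := hrun
    have hbP : PolyBounded b := ((PolyBounded.const _).mul hM).add (.const 1)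
    have hdP : PolyBounded fun n m => Fintype.card (Row k n m e) :=
      (PolyBounded.left.add (PolyBounded.right.mul
        (((PolyBounded.left.mul (.const 2)).pow k).mul (.const e)))).mono fun n m => card_row.le
    have hb21 : PolyBounded fun n m => 2 * b n m + 1 := ((PolyBounded.const 2).mul hbP).add (.const 1)
    obtain ⟨c', hc'⟩ := ((((PolyBounded.left.add hdP).add hbP).add (.const 2)).pow c).add
      (((hdP.mul hb21).mul (.const (k + 2))).add (hb21.mul (PolyBounded.right.add (.const 2))))
    refine ⟨c', fun n m => ?_⟩
    have h1 := hc n _ (b n m) _ (hbasis n m)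
    have h2 : ((C n m).size : ℝ) ≤ _ := Nat.cast_le.2 (hC n m)
    have h3 := (Nat.cast_le (α := ℝ)).2 (hc' n m)
    rw [Nat.cast_add] at h2 h3
    rw [Nat.cast_pow, Nat.cast_pow] at h3
    have h4 := hT n
    calc ((C n m).size : ℝ) ≤ _ := h2
      _ ≤ T n * _ + T n * _ := add_le_add h1 (le_mul_of_one_le_left (Nat.cast_nonneg _) h4)
      _ = T n * (_ + _) := (mul_add _ _ _).symm
      _ ≤ _ := mul_le_mul_of_nonneg_left h3 (by linarith)
  · have hsol := hA n _ (b n m) (gadgetMatrix k n m (a n m) (V n m))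
      (fun i => ((gadgetTarget (a n m) (V n m) (tOn n m) (tOff n m) (fun i c => decide (Φ i = c))
        ((Fintype.equivFin (Row k n m e)).symm i) : ℤ) : ℚ)) (r n m W : ℚ) (hbasis n m)
      (fun i => fitsIn_intCast (hb1 n m)
        ((abs_gadgetTarget_le (ha n m) (hV n m) (hOn n m) (hOff n m) _ _).trans (hbM n m).le))
      (fitsIn_intCast (hb1 n m) ((hr n m W).trans ?_)) (by exact_mod_cast hr0 n m W)
    · rw [hCe]
      constructor
      · intro h
        by_contra hP
        obtain ⟨r', hr', hz⟩ := hno n m Φ W hP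
        -- The distance is an infimum, so strictness needs the uniform bound `r'` above `γ` times
        -- the radius.
        have h' := hsol.2 (lt_of_lt_of_le (by simpa using hr') (le_lpDist (Set.range_nonempty _) ?_))
        · rw [h] at h'
          exact absurd h' (by simp)
        · rintro _ ⟨z, rfl⟩
          refine (hz z).trans (le_of_eq ?_)
          rw [gadgetNorm, ← gadgetMatrix_mulVec_sub]
      · intro hP
        obtain ⟨z, hz⟩ := hyes n m Φ W hP
        refine hsol.1 ((lpDist_le (Set.mem_range_self z)).trans ?_)
        rw [Rat.cast_intCast]
        refine le_trans (le_of_eq ?_) hz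
        rw [gadgetNorm, ← gadgetMatrix_mulVec_sub]
    · have := hbM n m
      have : (0 : ℤ) ≤ M n m := by positivity
      nlinarith

/-- Max-`k`-SAT circuits solve `k`-SAT: use the number of clauses as the threshold. -/
theorem exists_satFamily {k : ℕ} {T : ℕ → ℝ} (hT : ∀ n, 1 ≤ T n) {C : MaxSatFamily k}
    (hC : C.HasSize T) : ∃ C' : SatFamily k, C'.HasSize T ∧ ∀ n m Φ,
      (C' n m).eval (Formula.encode Φ) = (C n m).eval (encodeMax Φ (Fin.last m)) := by
  have h : ∀ n m : ℕ, ∃ C' : Circuit (FormulaBits k n m), C'.size ≤ (C n m).size + (m + 1) ∧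
      ∀ Φ, C'.eval (Formula.encode Φ) = (C n m).eval (encodeMax Φ (Fin.last m)) := by
    intro n m
    have h1 : Computes (m + 1) (fun (_ : FormulaBits k n m → Bool) (w : Fin (m + 1)) =>
        decide (Fin.last m = w)) :=
      (Computes.const_pi _).mono (by simp)
    obtain ⟨C', h2, h3⟩ := (((Computes.wire id).pair h1).comp
      (Computes.circuit (C n m))).exists_circuit
    exact ⟨C', h2.trans (by omega), fun Φ => h3 _⟩
  choose C' h1 h2 using h
  obtain ⟨c, hc⟩ := hC
  obtain ⟨c', hc'⟩ := (((PolyBounded.left.add PolyBounded.right).add (.const 2)).pow c).add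
    (PolyBounded.right.add (.const 1))
  refine ⟨C', ⟨c', fun n m => ?_⟩, h2⟩
  have h3 : ((C' n m).size : ℝ) ≤ _ := Nat.cast_le.2 (h1 n m)
  have h4 := (Nat.cast_le (α := ℝ)).2 (hc' n m)
  rw [Nat.cast_add] at h3 h4
  rw [Nat.cast_pow, Nat.cast_pow] at h4
  calc ((C' n m).size : ℝ) ≤ _ := h3
    _ ≤ T n * _ + T n * _ :=
      add_le_add (hc n m) (le_mul_of_one_le_left (Nat.cast_nonneg _) (hT n))
    _ = T n * (_ + _) := (mul_add _ _ _).symm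
    _ ≤ _ := mul_le_mul_of_nonneg_left h4 (by linarith [hT n])

/-! ### Assignments as lattice points -/

/-- The `0`-`1` vector of an assignment. -/
def boolPoint {n : ℕ} (y : Fin n → Bool) : Fin n → ℤ := fun j => if y j then 1 else 0

theorem litValue_boolPoint {n : ℕ} (y : Fin n → Bool) (l : Literal n) :
    litValue (boolPoint y) l = if y l.1 = l.2 then 1 else 0 := by
  obtain ⟨j, b⟩ := l
  cases b <;> cases h : y j <;> simp [litValue, boolPoint, h]

/-- The number `2 * z j - 1` is odd, so its absolute value is 1 exactly for `z j ∈ {0, 1}` and at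
least 3 otherwise. -/
theorem eq_boolPoint_or {n : ℕ} (z : Fin n → ℤ) :
    (∃ y, z = boolPoint y) ∨ ∃ j, 3 ≤ |2 * z j - 1| := by
  by_cases h : ∀ j, z j = 0 ∨ z j = 1
  · refine .inl ⟨fun j => decide (z j = 1), funext fun j => ?_⟩
    rcases h j with h | h <;> simp [boolPoint, h]
  · push Not at h
    obtain ⟨j, h0, h1⟩ := h
    exact .inr ⟨j, le_abs.2 (by omega)⟩

/-! ### The maximum norm -/

theorem lpNorm_top {d : ℕ} (v : Fin d → ℝ) : lpNorm ⊤ v = ‖v‖ := PiLp.norm_toLp v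

/-- Algorithms for approximate `CVPP_∞` solve `k`-SAT. -/
theorem exists_satFamily_of_top {k : ℕ} (hk : 1 ≤ k) {γ : ℝ} (hγ : γ * k < k + 1) {A : Algorithm}
    (hA : A.Solves ⊤ γ) {T : ℕ → ℝ} (hT : ∀ n, 1 ≤ T n) (hrun : A.RunsIn T) :
    ∃ C : SatFamily k, C.Solves ∧ C.HasSize T := by
  -- With `w` true literals the block value is `2 w - k` when off and `2 w - (k + 1)` when on. Both
  -- lie in `[-k, k]`, except that the latter is `-(k + 1)` for `w = 0`. A non-Boolean coordinate
  -- costs at least `3 k ≥ k + 1`.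
  refine Exists.elim (exists_maxSatFamily hA hT hrun (k := k) (e := 1) (.const (k + 2))
    (fun _ _ => k) (fun _ _ _ _ => 2) (fun _ _ _ => k + 1) (fun _ _ _ => k) (fun _ _ _ => k)
    (fun _ _ => by positivity) (fun _ _ => by simp) (fun _ _ _ _ => by simp)
    (fun _ _ _ => by rw [abs_of_nonneg (by positivity)]; push_cast; linarith) (fun _ _ _ => by simp)
    (fun _ _ _ => by positivity) (fun _ _ _ => by simp)
    (fun n m Φ _ => ∃ y : Fin n → Bool, ∀ i, SatisfiesClause y (Φ i)) ?yes ?no) ?main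
  case main =>
    rintro C ⟨hC, hCe⟩
    obtain ⟨C', hC', hCe'⟩ := exists_satFamily hT hC
    exact ⟨C', fun n m Φ => by rw [hCe', hCe], hC'⟩
  case yes =>
    rintro n m Φ W ⟨y, hy⟩
    refine ⟨boolPoint y, ?_⟩
    rw [gadgetNorm, lpNorm_top, pi_norm_le_iff_of_nonneg (by positivity)]
    intro i
    rw [Real.norm_eq_abs]
    norm_cast
    rcases (Fintype.equivFin (Row k n m 1)).symm i with j | ⟨j, c, l⟩
    · simp only [gadgetVec, boolPoint]
      split_ifs <;> simp
    · have h0 : 0 ≤ ∑ s, litValue (boolPoint y) (c s) := Finset.sum_nonneg fun s _ => by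
        rw [litValue_boolPoint]
        split_ifs <;> simp
      have h1 : ∑ s, litValue (boolPoint y) (c s) ≤ k := by
        refine (Finset.sum_le_card_nsmul _ _ 1 fun s _ => ?_).trans (by simp)
        rw [litValue_boolPoint]
        split_ifs <;> simp
      simp only [gadgetVec, ← Finset.mul_sum]
      split_ifs with hc
      · have h2 : 0 < ∑ s, litValue (boolPoint y) (c s) := by
          obtain ⟨s, hs⟩ := hy j
          rw [hc] at hs
          refine Finset.sum_pos' (fun s _ => ?_) ⟨s, Finset.mem_univ s, ?_⟩
          · rw [litValue_boolPoint]
            split_ifs <;> simp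
          · rw [litValue_boolPoint, if_pos hs]
            exact one_pos
        rw [abs_le]
        constructor <;> push_cast <;> linarith
      · rw [abs_le]
        constructor <;> linarith
  case no =>
    intro n m Φ W hP
    refine ⟨k + 1, by simpa using hγ, fun z => ?_⟩
    rw [gadgetNorm, lpNorm_top]
    have key : ∀ ρ : Row k n m 1, (k + 1 : ℤ) ≤ |gadgetVec (k : ℤ) (fun _ _ => 2) (fun _ => k + 1)
        (fun _ => k) Φ z ρ| → (k + 1 : ℝ) ≤ ‖fun i => (gadgetVec (k : ℤ) (fun _ _ => 2)
        (fun _ => k + 1) (fun _ => k) Φ z ((Fintype.equivFin (Row k n m 1)).symm i) : ℝ)‖ := by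
      intro ρ hρ
      refine le_trans ?_ (norm_le_pi_norm _ (Fintype.equivFin (Row k n m 1) ρ))
      rw [Equiv.symm_apply_apply, Real.norm_eq_abs]
      exact_mod_cast hρ
    rcases eq_boolPoint_or z with ⟨y, rfl⟩ | ⟨j, hj⟩
    · push Not at hP
      obtain ⟨i, hi⟩ := hP y
      refine key (.inr (i, Φ i, 0)) ?_
      have h0 : ∀ s, litValue (boolPoint y) (Φ i s) = 0 := fun s => by
        rw [litValue_boolPoint, if_neg (hi s)]
      simp only [gadgetVec, h0, if_true, mul_zero, Finset.sum_const_zero, zero_sub, abs_neg]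
      exact le_abs_self _
    · refine key (.inl j) ?_
      simp only [gadgetVec, abs_mul, Nat.abs_cast]
      have : (1 : ℤ) ≤ k := by exact_mod_cast hk
      nlinarith

/-! ### Finite `p` -/

/-- By convexity the power function lies above its tangent at the larger argument; this is
Bernoulli's inequality for `a / b`. -/
theorem abs_rpow_sub_rpow_le {p : ℝ} (hp : 1 ≤ p) {R a b : ℝ} (ha0 : 0 ≤ a) (hb0 : 0 ≤ b)
    (ha : a ≤ R) (hb : b ≤ R) : |a ^ p - b ^ p| ≤ p * R ^ (p - 1) * |a - b| := by
  wlog hab : a ≤ b generalizing a b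
  · rw [abs_sub_comm, abs_sub_comm a]
    exact this hb0 ha0 hb ha (le_of_not_ge hab)
  rcases hb0.eq_or_lt with rfl | hb1
  · rw [le_antisymm hab ha0]
    simp
  have h1 := Real.rpow_le_rpow ha0 hab (by linarith : 0 ≤ p)
  rw [abs_sub_comm, abs_of_nonneg (sub_nonneg.2 h1), abs_sub_comm, abs_of_nonneg (sub_nonneg.2 hab)]
  have h2 := one_add_mul_self_le_rpow_one_add (s := a / b - 1) (by linarith [div_nonneg ha0 hb0]) hp
  rw [add_sub_cancel, Real.div_rpow ha0 hb0, le_div_iff₀ (by positivity)] at h2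
  have h3 : b ^ p = b ^ (p - 1) * b := by rw [Real.rpow_sub_one hb1.ne']; field_simp
  have h4 : b ^ (p - 1) ≤ R ^ (p - 1) := Real.rpow_le_rpow hb0 hb (by linarith)
  have h5 : (1 + p * (a / b - 1)) * b ^ p = b ^ p + p * b ^ (p - 1) * (a - b) := by
    rw [h3]
    field_simp
  have h6 : p * b ^ (p - 1) * (b - a) ≤ p * R ^ (p - 1) * (b - a) := by
    have := sub_nonneg.2 hab
    gcongr
  linarith

/-- Rounding the scaled coordinates of an affine form changes the `p`-th power of its values little. -/
theorem abs_rpow_round_sub_le {p : ℝ} (hp : 1 ≤ p) {R w : ℝ} {D : ℝ} (hD : 1 ≤ D) {a a' : ℝ}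
    (haR : |a| + w ≤ R) (haw : |a' - D * a| ≤ w) :
    |(|a'| ^ p - D ^ p * |a| ^ p)| ≤ p * R ^ (p - 1) * w * (D ^ p / D) := by
  have hw : 0 ≤ w := (abs_nonneg _).trans haw
  have hR : 0 ≤ R := le_trans (by positivity) haR
  have h1 : |D * a| ≤ D * R := by
    rw [abs_mul, abs_of_nonneg (by linarith : 0 ≤ D)]
    gcongr
    linarith
  have h2 : |a'| ≤ D * R := by
    have h3 : |a'| ≤ |a' - D * a| + |D * a| := by simpa using abs_add_le (a' - D * a) (D * a)
    rw [abs_mul, abs_of_nonneg (by linarith : 0 ≤ D)] at h3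
    nlinarith
  have h3 := abs_rpow_sub_rpow_le hp (abs_nonneg a') (abs_nonneg (D * a)) h2 h1
  have h4 : |D * a| ^ p = D ^ p * |a| ^ p := by
    rw [abs_mul, abs_of_nonneg (by linarith : 0 ≤ D), Real.mul_rpow (by linarith) (abs_nonneg _)]
  rw [h4] at h3
  refine h3.trans ?_
  rw [Real.mul_rpow (by linarith) hR, Real.rpow_sub_one (by linarith : D ≠ 0)]
  calc p * (D ^ p / D * R ^ (p - 1)) * |(|a'| - |D * a|)|
      ≤ p * (D ^ p / D * R ^ (p - 1)) * w := by
        gcongr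
        exact (abs_abs_sub_abs_le_abs_sub _ _).trans haw
    _ = p * R ^ (p - 1) * w * (D ^ p / D) := by ring

theorem abs_ceil_sub_le (x : ℝ) : |(⌈x⌉ : ℝ) - x| ≤ 1 :=
  abs_le.2 ⟨by linarith [Int.le_ceil x], by linarith [Int.ceil_lt_add_one x]⟩

theorem exists_rounding {p : ℝ} (hp : 1 ≤ p) {e k : ℕ} (V : Matrix (Fin e) (Fin k) ℝ) (t : Fin e → ℝ) :
    ∃ K : ℕ, ∀ D : ℕ, 1 ≤ D → (∀ l s, |⌈D * V l s⌉| ≤ K * D) ∧ (∀ l, |⌈D * t l⌉| ≤ K * D) ∧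
      ∀ x : Fin k → ℤ, (∀ s, x s = 0 ∨ x s = 1) →
        |∑ l, |((∑ s, ⌈D * V l s⌉ * x s - ⌈D * t l⌉ : ℤ) : ℝ)| ^ p -
          (D : ℝ) ^ p * ∑ l, |(V.mulVec (fun s => (x s : ℝ)) - t) l| ^ p| ≤ K * ((D : ℝ) ^ p / D) := by
  -- `R` bounds every row value on the cube plus `k + 1`, the rounding error of `k` columns and the
  -- target.
  set R : ℝ := ∑ l, (∑ s, |V l s| + |t l|) + (k + 1) with hR
  have hRl : ∀ l, ∑ s, |V l s| + |t l| + (k + 1) ≤ R := fun l => by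
    rw [hR]
    gcongr
    exact Finset.single_le_sum (f := fun l => ∑ s, |V l s| + |t l|) (fun l _ => by positivity)
      (Finset.mem_univ l)
  have hceil : ∀ (D : ℕ) (x : ℝ), 1 ≤ D → |x| + 1 ≤ R → |⌈D * x⌉| ≤ (⌈R⌉₊ : ℤ) * D := by
    intro D x hD hx
    have h1 : (1 : ℝ) ≤ D := by exact_mod_cast hD
    have h2 := abs_ceil_sub_le (D * x)
    have h3 : |(⌈D * x⌉ : ℝ)| ≤ |⌈D * x⌉ - D * x| + |D * x| := by
      simpa using abs_add_le (⌈D * x⌉ - D * x) (D * x)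
    rw [abs_mul, Nat.abs_cast] at h3
    have h4 := Nat.le_ceil R
    have h5 : |(⌈D * x⌉ : ℝ)| ≤ ⌈R⌉₊ * D := by nlinarith
    exact_mod_cast h5
  -- The first summand of `K` bounds the entries, the second the total error over `e` rows.
  refine ⟨⌈R⌉₊ + e * ⌈p * R ^ (p - 1) * (k + 1)⌉₊, fun D hD => ⟨fun l s => ?_, fun l => ?_, fun x hx => ?_⟩⟩
  · refine (hceil D _ hD ((le_trans ?_ (hRl l)))).trans (by push_cast; gcongr; exact le_add_of_nonneg_right (by positivity))
    have : |V l s| ≤ ∑ s, |V l s| :=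
      Finset.single_le_sum (f := fun s => |V l s|) (fun s _ => abs_nonneg _) (Finset.mem_univ s)
    have := abs_nonneg (t l)
    have : (0 : ℝ) ≤ k := by positivity
    linarith
  · refine (hceil D _ hD ((le_trans ?_ (hRl l)))).trans (by push_cast; gcongr; exact le_add_of_nonneg_right (by positivity))
    have : 0 ≤ ∑ s, |V l s| := by positivity
    have : (0 : ℝ) ≤ k := by positivity
    linarith
  · have hD' : (1 : ℝ) ≤ D := by exact_mod_cast hD
    have hx' : ∀ s, |(x s : ℝ)| ≤ 1 := fun s => by rcases hx s with h | h <;> simp [h]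
    rw [Finset.mul_sum, ← Finset.sum_sub_distrib]
    calc |∑ l, _| ≤ ∑ l : Fin e, _ := Finset.abs_sum_le_sum_abs _ _
      _ ≤ ∑ l : Fin e, p * R ^ (p - 1) * (k + 1) * ((D : ℝ) ^ p / D) := by
        refine Finset.sum_le_sum fun l _ => abs_rpow_round_sub_le hp hD' ?_ ?_
        · refine le_trans ?_ (hRl l)
          gcongr
          refine (abs_sub _ _).trans ?_
          gcongr
          rw [Matrix.mulVec, dotProduct]
          refine (Finset.abs_sum_le_sum_abs _ _).trans (Finset.sum_le_sum fun s _ => ?_)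
          rw [abs_mul]
          exact mul_le_of_le_one_right (abs_nonneg _) (hx' s)
        · have : ((∑ s, ⌈D * V l s⌉ * x s - ⌈D * t l⌉ : ℤ) : ℝ) -
              D * (V.mulVec (fun s => (x s : ℝ)) - t) l =
              ∑ s, (⌈D * V l s⌉ - D * V l s) * x s - (⌈D * t l⌉ - D * t l) := by
            simp only [Matrix.mulVec, dotProduct, Pi.sub_apply, mul_sub, sub_mul, Finset.mul_sum,
              Finset.sum_sub_distrib, mul_assoc]
            push_cast
            ring
          rw [this]
          refine (abs_sub _ _).trans (add_le_add ((Finset.abs_sum_le_sum_abs _ _).trans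
            ((Finset.sum_le_card_nsmul _ _ 1 fun s _ => ?_).trans (by simp))) (abs_ceil_sub_le _))
          rw [abs_mul]
          exact mul_le_one₀ (abs_ceil_sub_le _) (abs_nonneg _) (hx' s)
      _ = e * (p * R ^ (p - 1) * (k + 1)) * ((D : ℝ) ^ p / D) := by simp; ring
      _ ≤ _ := by
        gcongr
        push_cast
        have := Nat.le_ceil (p * R ^ (p - 1) * (k + 1))
        have h0 : (0 : ℝ) ≤ ⌈R⌉₊ := by positivity
        have h1 : (0 : ℝ) ≤ e := by positivity
        nlinarith

/-- An integral version of on-off isolating parallelepipeds, at any sufficiently fine scale `D`. -/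
theorem exists_integral_onOff {p : ℝ} (hp : 1 ≤ p) {e k : ℕ} {V : Matrix (Fin e) (Fin k) ℝ}
    {tOn tOff : Fin e → ℝ} (h : IsOnOffIsolating (ENNReal.ofReal p) V tOn tOff) :
    ∃ δ : ℝ, 0 < δ ∧ ∃ K : ℕ, ∀ D : ℕ, 1 ≤ D → ∃ (V' : Fin e → Fin k → ℤ) (tOn' tOff' : Fin e → ℤ),
      (∀ l s, |V' l s| ≤ K * D) ∧ (∀ l, |tOn' l| ≤ K * D) ∧ (∀ l, |tOff' l| ≤ K * D) ∧
      ∀ x : Fin k → ℤ, (∀ s, x s = 0 ∨ x s = 1) →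
        |∑ l, |((∑ s, V' l s * x s - tOn' l : ℤ) : ℝ)| ^ p -
          (D : ℝ) ^ p * (1 + if x = 0 then δ else 0)| ≤ K * ((D : ℝ) ^ p / D) ∧
        |∑ l, |((∑ s, V' l s * x s - tOff' l : ℤ) : ℝ)| ^ p - (D : ℝ) ^ p * 1| ≤
          K * ((D : ℝ) ^ p / D) := by
  have : Fact (1 ≤ ENNReal.ofReal p) := ⟨by simpa using hp⟩
  have hp0 : 0 < p := by linarith
  obtain ⟨h1, h2, h3⟩ := h
  obtain ⟨K, hK⟩ := exists_rounding hp V tOn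
  obtain ⟨K', hK'⟩ := exists_rounding hp V tOff
  refine ⟨lpNorm (ENNReal.ofReal p) tOn ^ p - 1, sub_pos.2 (Real.one_lt_rpow h2 hp0), K + K',
    fun D hD => ⟨fun l s => ⌈D * V l s⌉, fun l => ⌈D * tOn l⌉, fun l => ⌈D * tOff l⌉,
      fun l s => ((hK D hD).1 l s).trans ?_, fun l => ((hK D hD).2.1 l).trans ?_,
      fun l => ((hK' D hD).2.1 l).trans ?_, fun x hx => ⟨?_, ?_⟩⟩⟩
  · push_cast; gcongr; simp
  · push_cast; gcongr; simp
  · push_cast; gcongr; simp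
  · have hOn : ∑ l, |(V.mulVec (fun s => (x s : ℝ)) - tOn) l| ^ p =
        1 + if x = 0 then lpNorm (ENNReal.ofReal p) tOn ^ p - 1 else 0 := by
      split_ifs with h0
      · rw [h0, lpNorm_rpow hp]
        simp [Matrix.mulVec, dotProduct]
      · rw [← lpNorm_rpow hp, h1 _ (fun s => by simpa using mod_cast hx s)
          fun h => h0 (funext fun s => by simpa using congrFun h s), Real.one_rpow, add_zero]
    have := (hK D hD).2.2 x hx
    rw [hOn] at this
    refine this.trans ?_
    push_cast
    gcongr
    simp
  · have hOff : ∑ l, |(V.mulVec (fun s => (x s : ℝ)) - tOff) l| ^ p = 1 := by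
      rw [← lpNorm_rpow hp, h3 _ (fun s => by simpa using mod_cast hx s), Real.one_rpow]
    have := (hK' D hD).2.2 x hx
    rw [hOff] at this
    refine this.trans ?_
    push_cast
    gcongr
    simp

section FiniteExponent

variable {p : ℝ} {k n m e : ℕ}

theorem gadgetNorm_nonneg (p : ENNReal) [Fact (1 ≤ p)] (a : ℤ) (V : Fin e → Fin k → ℤ)
    (tOn tOff : Fin e → ℤ) (Φ : Formula k n m) (z : Fin n → ℤ) :
    0 ≤ gadgetNorm p a V tOn tOff Φ z := lpNorm_nonneg _ _

theorem gadgetNorm_rpow (hp : 1 ≤ p) (a : ℤ) (V : Fin e → Fin k → ℤ) (tOn tOff : Fin e → ℤ)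
    (Φ : Formula k n m) (z : Fin n → ℤ) :
    gadgetNorm (ENNReal.ofReal p) a V tOn tOff Φ z ^ p =
      ∑ j, |(a : ℝ)| ^ p * |(2 * z j - 1 : ℝ)| ^ p + ∑ i : Fin m, ∑ c : Fin k → Literal n,
        ∑ l, |((∑ s, V l s * litValue z (c s) - if Φ i = c then tOn l else tOff l : ℤ) : ℝ)| ^ p := by
  rw [gadgetNorm, lpNorm_rpow hp, (Fintype.equivFin (Row k n m e)).symm.sum_comp
    (fun ρ => |(gadgetVec a V tOn tOff Φ z ρ : ℝ)| ^ p), Fintype.sum_sum_type]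
  congr 1
  · refine Finset.sum_congr rfl fun j _ => ?_
    simp only [gadgetVec]
    push_cast
    rw [abs_mul, Real.mul_rpow (abs_nonneg _) (abs_nonneg _)]
  · rw [Fintype.sum_prod_type]
    refine Finset.sum_congr rfl fun i _ => ?_
    rw [Fintype.sum_prod_type]
    rfl

/-- Every block contributes 1, and among those of position `i` only the block of `Φ i` can add `δ`.
-/
theorem sum_unsatisfied (Φ : Formula k n m) (y : Fin n → Bool) (δ : ℝ) :
    ∑ i : Fin m, ∑ c : Fin k → Literal n,
      (1 + if Φ i = c then (if SatisfiesClause y c then 0 else δ) else 0) =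
      (m * (n * 2) ^ k : ℕ) + (m - numSatisfied Φ y) * δ := by
  have h : ∀ i : Fin m, ∑ c : Fin k → Literal n,
      (1 + if Φ i = c then (if SatisfiesClause y c then 0 else δ) else 0) =
      ((n * 2) ^ k : ℕ) + (δ - if SatisfiesClause y (Φ i) then δ else 0) := by
    intro i
    rw [Finset.sum_add_distrib, Finset.sum_ite_eq, if_pos (Finset.mem_univ _)]
    congr 1
    · simp
    · split_ifs <;> simp
  rw [Finset.sum_congr rfl fun i _ => h i, Finset.sum_add_distrib, Finset.sum_sub_distrib,
    ← Finset.sum_filter]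
  simp [numSatisfied]
  ring

/-- For `0`-`1` points, the distance measures the number of satisfied clauses. -/
theorem abs_gadgetNorm_rpow_boolPoint_sub_le (hp : 1 ≤ p) {D : ℕ} (a : ℕ) {V : Fin e → Fin k → ℤ}
    {tOn tOff : Fin e → ℤ} {δ E : ℝ}
    (h : ∀ x : Fin k → ℤ, (∀ s, x s = 0 ∨ x s = 1) →
        |∑ l, |((∑ s, V l s * x s - tOn l : ℤ) : ℝ)| ^ p -
          (D : ℝ) ^ p * (1 + if x = 0 then δ else 0)| ≤ E ∧
        |∑ l, |((∑ s, V l s * x s - tOff l : ℤ) : ℝ)| ^ p - (D : ℝ) ^ p * 1| ≤ E)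
    (Φ : Formula k n m) (y : Fin n → Bool) :
    |gadgetNorm (ENNReal.ofReal p) ((a * D : ℕ) : ℤ) V tOn tOff Φ (boolPoint y) ^ p - (D : ℝ) ^ p *
      (n * (a : ℝ) ^ p + ((m * (n * 2) ^ k : ℕ) + (m - numSatisfied Φ y) * δ))| ≤
      (m * (n * 2) ^ k : ℕ) * E := by
  have h1 : ∑ j, |(((a * D : ℕ) : ℤ) : ℝ)| ^ p * |(2 * (boolPoint y j : ℝ) - 1 : ℝ)| ^ p =
      (D : ℝ) ^ p * (n * (a : ℝ) ^ p) := by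
    have : ∀ j, |(2 * (boolPoint y j : ℝ) - 1 : ℝ)| = 1 := fun j => by
      simp only [boolPoint]
      split_ifs <;> norm_num
    simp only [this, Real.one_rpow, mul_one, Finset.sum_const, Finset.card_univ, Fintype.card_fin,
      nsmul_eq_mul]
    push_cast
    rw [abs_of_nonneg (by positivity), Real.mul_rpow (by positivity) (by positivity)]
    ring
  rw [gadgetNorm_rpow hp, h1, mul_add, add_sub_add_left_eq_sub, ← sum_unsatisfied]
  simp only [Finset.mul_sum, ← Finset.sum_sub_distrib]
  refine (Finset.abs_sum_le_sum_abs _ _).trans ((Finset.sum_le_card_nsmul _ _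
    (((n * 2) ^ k : ℕ) * E) fun i _ => (Finset.abs_sum_le_sum_abs _ _).trans
    ((Finset.sum_le_card_nsmul _ _ E fun c _ => ?_).trans (le_of_eq (by simp)))).trans
    (le_of_eq (by simp [mul_assoc])))
  -- The block is evaluated at the vector of literal values, which is the origin exactly when the
  -- clause is violated.
  obtain ⟨h2, h3⟩ := h (fun s => litValue (boolPoint y) (c s)) fun s => by
    rw [litValue_boolPoint]
    split_ifs <;> simp
  by_cases hc : Φ i = c
  · have hs : ((fun s => litValue (boolPoint y) (c s)) = 0) ↔ ¬ SatisfiesClause y c := by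
      simp [funext_iff, litValue_boolPoint]
    simp only [hc, if_true]
    by_cases hy : SatisfiesClause y c
    · rw [if_neg (mt hs.1 (not_not.2 hy))] at h2
      rwa [if_pos hy]
    · rw [if_pos (hs.2 hy)] at h2
      rwa [if_neg hy]
  · simpa only [hc, if_false, add_zero] using h3

/-- The variable rows alone suffice: each coordinate pays at least `a^p` in units of `D^p`, and
coordinate `j` at least `3^p ≥ 3` times that. -/
theorem le_gadgetNorm_rpow (hp : 1 ≤ p) {D : ℕ} (a : ℕ) (V : Fin e → Fin k → ℤ)
    (tOn tOff : Fin e → ℤ) (Φ : Formula k n m) {z : Fin n → ℤ} {j : Fin n} (hj : 3 ≤ |2 * z j - 1|) :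
    (D : ℝ) ^ p * (n * (a : ℝ) ^ p + 2 * (a : ℝ) ^ p) ≤
      gadgetNorm (ENNReal.ofReal p) ((a * D : ℕ) : ℤ) V tOn tOff Φ z ^ p := by
  have hp0 : 0 ≤ p := by linarith
  have h1 : ∀ i, (1 : ℝ) + (if i = j then 2 else 0) ≤ |(2 * z i - 1 : ℝ)| ^ p := by
    intro i
    split_ifs with h
    · have h3 : (3 : ℝ) ≤ |(2 * z i - 1 : ℝ)| := by rw [h]; exact_mod_cast hj
      calc (1 + 2 : ℝ) = 3 := by norm_num
        _ ≤ _ := h3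
        _ = |(2 * z i - 1 : ℝ)| ^ (1 : ℝ) := (Real.rpow_one _).symm
        _ ≤ _ := Real.rpow_le_rpow_of_exponent_le (by linarith) hp
    · have h3 : (1 : ℝ) ≤ |(2 * z i - 1 : ℝ)| := by
        have : (1 : ℤ) ≤ |2 * z i - 1| := by
          rw [le_abs]
          omega
        exact_mod_cast this
      simpa using Real.one_le_rpow h3 hp0
  rw [gadgetNorm_rpow hp]
  refine le_trans ?_ (le_add_of_nonneg_right (by positivity))
  rw [← Finset.mul_sum]
  have h2 : (n : ℝ) + 2 ≤ ∑ i, |(2 * z i - 1 : ℝ)| ^ p := by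
    refine le_trans (le_of_eq ?_) (Finset.sum_le_sum fun i _ => h1 i)
    simp [Finset.sum_add_distrib]
  push_cast
  rw [abs_of_nonneg (by positivity), Real.mul_rpow (by positivity) (by positivity)]
  calc (D : ℝ) ^ p * (n * (a : ℝ) ^ p + 2 * (a : ℝ) ^ p) = (a : ℝ) ^ p * (D : ℝ) ^ p * (n + 2) := by ring
    _ ≤ _ := by gcongr

/-- Rounding up leaves room below a threshold. -/
theorem ceil_rpow_lt (hp : 1 ≤ p) {D : ℕ} (hD : 1 ≤ D) {q δ U : ℝ} (hq : 0 ≤ q)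
    (hU : q + 2 ≤ U) (hDU : p * U ^ p < D * δ) :
    (⌈D * q ^ p⁻¹⌉ : ℝ) < D * (q + δ) ^ p⁻¹ := by
  have hp0 : 0 < p := by linarith
  have hD1 : (1 : ℝ) ≤ D := by exact_mod_cast hD
  have hU1 : 1 ≤ U := by linarith
  have hδ : 0 ≤ δ := by
    have : 0 ≤ p * U ^ p := by positivity
    by_contra! h
    nlinarith
  set r := q ^ p⁻¹ with hr
  have hr0 : 0 ≤ r := by positivity
  have hrp : r ^ p = q := Real.rpow_inv_rpow hq hp0.ne'
  have hr1 : r ≤ q + 1 := by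
    by_contra! h
    have h1 : 1 ≤ r := by linarith
    have h2 := Real.rpow_le_rpow_of_exponent_le h1 hp
    rw [Real.rpow_one, hrp] at h2
    linarith
  refine lt_of_lt_of_le (Int.ceil_lt_add_one _) ?_
  -- Raising to the power `p` turns the shift `1 / D` into an error of at most `p * U^(p - 1) / D`,
  -- which is at most `δ`.
  have hlt : r + 1 / D ≤ (q + δ) ^ p⁻¹ := by
    rw [Real.le_rpow_inv_iff_of_pos (by positivity) (by positivity) hp0]
    have hD2 : 1 / (D : ℝ) ≤ 1 := by rw [div_le_one (by linarith)]; exact hD1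
    have h1 := abs_rpow_sub_rpow_le hp (R := U) (a := r + 1 / D) (b := r) (by positivity) hr0
      (by linarith) (by linarith)
    rw [add_sub_cancel_left, abs_of_nonneg (by positivity : 0 ≤ 1 / (D : ℝ)), hrp] at h1
    have h2 := (abs_le.1 h1).2
    have h3 : U ^ (p - 1) ≤ U ^ p := Real.rpow_le_rpow_of_exponent_le hU1 (by linarith)
    have h4 : p * U ^ (p - 1) * (1 / D) ≤ δ := by
      rw [mul_one_div, div_le_iff₀ (by linarith)]
      nlinarith
    linarith
  calc (D : ℝ) * r + 1 = D * (r + 1 / D) := by field_simp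
    _ ≤ _ := by gcongr

end FiniteExponent

/-- Algorithms for `CVPP_p` solve Max-`k`-SAT if there is a `(p, k)`-on-off isolating
parallelepiped. -/
theorem exists_maxSatFamily_of_onOff {p : ℝ} (hp : 1 ≤ p) {e k : ℕ} {V : Matrix (Fin e) (Fin k) ℝ}
    {tOn tOff : Fin e → ℝ} (h : IsOnOffIsolating (ENNReal.ofReal p) V tOn tOff) {A : Algorithm}
    (hA : A.Solves (ENNReal.ofReal p) 1) {T : ℕ → ℝ} (hT : ∀ n, 1 ≤ T n) (hrun : A.RunsIn T) :
    ∃ C : MaxSatFamily k, C.Solves ∧ C.HasSize T := by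
  have : Fact (1 ≤ ENNReal.ofReal p) := ⟨by simpa using hp⟩
  have hp0 : 0 < p := by linarith
  obtain ⟨δ, hδ, K, hK⟩ := exists_integral_onOff hp h
  set c := ⌈p⌉₊ with hc
  have hpc : p ≤ c := Nat.le_ceil p
  have hc1 : 1 ≤ c := by exact_mod_cast hp.trans hpc
  set Δ := ⌈δ⌉₊ with hΔ
  have hδΔ : δ ≤ Δ := Nat.le_ceil δ
  let N : ℕ → ℕ → ℕ := fun n m => m * (n * 2) ^ k
  -- The penalty exceeds everything the clause blocks can add to the threshold, so non-Boolean
  -- points never matter.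
  let a : ℕ → ℕ → ℕ := fun n m => N n m + (m + 1) * Δ + 1
  let U : ℕ → ℕ → ℕ := fun n m => n * a n m ^ c + N n m + (m + 1) * Δ + 2
  let B : ℕ := ⌈4 * (c + K) / δ⌉₊
  -- This scale serves two purposes: rounding the blocks costs at most `δ / 4` in units of `D^p`,
  -- and rounding up the radius costs less than `δ / 2`. The integer exponent `c ≥ p` keeps it a
  -- polynomial.
  let D : ℕ → ℕ → ℕ := fun n m => B * U n m ^ c + 1
  have hNP : PolyBounded N := PolyBounded.right.mul ((PolyBounded.left.mul (.const 2)).pow k)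
  have haP : PolyBounded a :=
    (hNP.add ((PolyBounded.right.add (.const 1)).mul (.const Δ))).add (.const 1)
  have hUP : PolyBounded U := (((PolyBounded.left.mul (haP.pow c)).add hNP).add
    ((PolyBounded.right.add (.const 1)).mul (.const Δ))).add (.const 2)
  have hDP : PolyBounded D := ((PolyBounded.const B).mul (hUP.pow c)).add (.const 1)
  have hD1 : ∀ n m, 1 ≤ D n m := fun n m => by simp [D]
  choose V' tOn' tOff' hV' hOn' hOff' hK' using fun n m => hK (D n m) (hD1 n m)
  -- the `p`-th power of the scaled threshold distance
  let q : ℕ → ∀ m : ℕ, Fin (m + 1) → ℝ := fun n m W =>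
    n * (a n m : ℝ) ^ p + (N n m + (m - (W : ℕ)) * δ) + δ / 4
  have hq0 : ∀ n m W, 0 < q n m W := by
    intro n m W
    have : (0 : ℝ) ≤ m - (W : ℕ) := sub_nonneg.2 (by exact_mod_cast W.is_le)
    positivity
  have hBU : ∀ n m, 4 * (c + K) * (U n m : ℝ) ^ c < D n m * δ := by
    intro n m
    have h1 : 4 * ((c : ℝ) + K) ≤ B * δ := by
      have := Nat.le_ceil (4 * ((c : ℝ) + K) / δ)
      rwa [div_le_iff₀ hδ] at this
    have h2 : (D n m : ℝ) = B * U n m ^ c + 1 := by simp [D]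
    have h3 : (0 : ℝ) ≤ (U n m : ℝ) ^ c := by positivity
    rw [h2]
    nlinarith
  have ha1 : ∀ n m, (1 : ℝ) ≤ a n m := fun n m => by
    have : 1 ≤ a n m := by simp [a]
    exact_mod_cast this
  have haU : ∀ n m W, q n m W + 2 ≤ (U n m : ℝ) := by
    intro n m W
    have h1 : (a n m : ℝ) ^ p ≤ (a n m : ℝ) ^ c := by
      rw [← Real.rpow_natCast]
      exact Real.rpow_le_rpow_of_exponent_le (ha1 n m) hpc
    have h2 : (n : ℝ) * (a n m : ℝ) ^ p ≤ n * (a n m : ℝ) ^ c := by gcongr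
    have h3 : (U n m : ℝ) = n * (a n m : ℝ) ^ c + N n m + (m + 1) * Δ + 2 := by simp [U]
    have h4 : (0 : ℝ) ≤ (W : ℕ) := by positivity
    have h5 : (0 : ℝ) ≤ m := by positivity
    rw [h3]
    simp only [q]
    nlinarith
  have hU1 : ∀ n m, (1 : ℝ) ≤ U n m := fun n m => by
    have : 1 ≤ U n m := by simp [U]
    exact_mod_cast this
  have hU : ∀ n m, (U n m : ℝ) ^ p ≤ (U n m : ℝ) ^ c := fun n m => by
    rw [← Real.rpow_natCast]
    exact Real.rpow_le_rpow_of_exponent_le (hU1 n m) hpc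
  have hNU : ∀ n m, (N n m : ℝ) ≤ (U n m : ℝ) ^ c := fun n m => by
    have h1 : N n m ≤ U n m := by simp [U]; omega
    have h2 : (N n m : ℝ) ≤ U n m := by exact_mod_cast h1
    exact h2.trans (le_self_pow₀ (hU1 n m) (by omega))
  have herr : ∀ n m, (N n m : ℝ) * (K * ((D n m : ℝ) ^ p / D n m)) ≤ (D n m : ℝ) ^ p * (δ / 4) := by
    intro n m
    have h1 : (0 : ℝ) < D n m := by exact_mod_cast hD1 n m
    have h2 : (N n m : ℝ) * K ≤ D n m * (δ / 4) := by
      have h3 := hBU n m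
      have h4 := hNU n m
      have h5 : (0 : ℝ) ≤ c * (U n m : ℝ) ^ c := by positivity
      have h6 : (N n m : ℝ) * K ≤ (U n m : ℝ) ^ c * K := by gcongr
      linarith
    calc (N n m : ℝ) * (K * ((D n m : ℝ) ^ p / D n m)) = N n m * K * ((D n m : ℝ) ^ p / D n m) := by ring
      _ ≤ D n m * (δ / 4) * ((D n m : ℝ) ^ p / D n m) := by gcongr
      _ = _ := by field_simp
  have hround : ∀ n m W, (⌈D n m * q n m W ^ p⁻¹⌉ : ℝ) < D n m * (q n m W + δ / 2) ^ p⁻¹ := by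
    intro n m W
    refine ceil_rpow_lt hp (hD1 n m) (hq0 n m W).le (haU n m W) ?_
    have h1 := hBU n m
    have h2 : p * (U n m : ℝ) ^ p ≤ c * (U n m : ℝ) ^ c := by gcongr; exact hU n m
    have h3 : (0 : ℝ) ≤ K * (U n m : ℝ) ^ c := by positivity
    have h4 : (0 : ℝ) < c * (U n m : ℝ) ^ c := by
      have := hU1 n m
      positivity
    nlinarith
  have hnorm : ∀ n m (Φ : Formula k n m) y, _ := fun n m Φ y =>
    abs_gadgetNorm_rpow_boolPoint_sub_le hp (a n m) (hK' n m) Φ y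
  refine Exists.elim (exists_maxSatFamily hA hT hrun (M := fun n m => D n m * (a n m + K + U n m))
    (hDP.mul ((haP.add (.const K)).add hUP)) (fun n m => ((a n m * D n m : ℕ) : ℤ)) V' tOn' tOff'
    (fun n m W => ⌈D n m * q n m W ^ p⁻¹⌉) ?_ ?_ ?_ ?_ ?_ ?_ ?_
    (fun n m Φ W => ∃ y : Fin n → Bool, (W : ℕ) ≤ numSatisfied Φ y) ?_ ?_) ?_
  · intro n m
    have h1 := hD1 n m
    have h2 : 0 < a n m := by simp [a]
    exact_mod_cast Nat.mul_pos h2 h1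
  · intro n m
    rw [Nat.abs_cast]
    norm_cast
    rw [mul_comm]
    exact Nat.mul_le_mul_left _ (by omega)
  · intro n m l s
    refine (hV' n m l s).trans ?_
    norm_cast
    rw [mul_comm]
    exact Nat.mul_le_mul_left _ (by omega)
  · intro n m l
    refine (hOn' n m l).trans ?_
    norm_cast
    rw [mul_comm]
    exact Nat.mul_le_mul_left _ (by omega)
  · intro n m l
    refine (hOff' n m l).trans ?_
    norm_cast
    rw [mul_comm]
    exact Nat.mul_le_mul_left _ (by omega)
  · intro n m W
    have h1 := hD1 n m
    have h2 := hq0 n m W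
    rw [Int.ceil_pos]
    positivity
  · intro n m W
    have h1 : (0 : ℝ) < D n m := by exact_mod_cast hD1 n m
    have h2 := hq0 n m W
    rw [abs_of_nonneg (Int.ceil_nonneg (by positivity)), Int.ceil_le]
    have h3 : q n m W ^ p⁻¹ ≤ U n m := by
      rw [Real.rpow_inv_le_iff_of_pos h2.le (by positivity) hp0]
      have h4 := Real.rpow_le_rpow_of_exponent_le (hU1 n m) hp
      rw [Real.rpow_one] at h4
      linarith [haU n m W]
    push_cast
    gcongr
    refine h3.trans (le_add_of_nonneg_left (by positivity))
  · rintro n m Φ W ⟨y, hy⟩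
    refine ⟨boolPoint y, le_trans ?_ (Int.le_ceil _)⟩
    have h1 : (0 : ℝ) < D n m := by exact_mod_cast hD1 n m
    have h2 := hq0 n m W
    refine (Real.rpow_le_rpow_iff (gadgetNorm_nonneg _ _ _ _ _ _ _) (by positivity) hp0).1 ?_
    rw [Real.mul_rpow h1.le (by positivity), Real.rpow_inv_rpow h2.le hp0.ne']
    have h3 := (abs_le.1 ((hnorm n m Φ y).trans (herr n m))).2
    have h4 : (n * (a n m : ℝ) ^ p + ((m * (n * 2) ^ k : ℕ) + (m - numSatisfied Φ y) * δ)) + δ / 4 ≤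
        q n m W := by
      have : ((W : ℕ) : ℝ) ≤ numSatisfied Φ y := by exact_mod_cast hy
      simp only [q, N]
      gcongr
    have h5 : (0 : ℝ) ≤ (D n m : ℝ) ^ p := by positivity
    have h6 := mul_le_mul_of_nonneg_left h4 h5
    rw [mul_add] at h6
    exact le_trans (by linarith) h6
  · intro n m Φ W hP
    push Not at hP
    -- A missing clause raises the exact value by `δ`. Subtracting the `δ / 4` already in `q` and
    -- the rounding error `δ / 4` leaves `δ / 2`.
    refine ⟨D n m * (q n m W + δ / 2) ^ p⁻¹, by rw [one_mul]; exact hround n m W, fun z => ?_⟩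
    have h1 : (0 : ℝ) < D n m := by exact_mod_cast hD1 n m
    have h2 := hq0 n m W
    refine (Real.rpow_le_rpow_iff (by positivity) (gadgetNorm_nonneg _ _ _ _ _ _ _) hp0).1 ?_
    rw [Real.mul_rpow h1.le (by positivity), Real.rpow_inv_rpow (by positivity) hp0.ne']
    have h5 : (0 : ℝ) ≤ (D n m : ℝ) ^ p := by positivity
    rcases eq_boolPoint_or z with ⟨y, rfl⟩ | ⟨j, hj⟩
    · have h3 := (abs_le.1 ((hnorm n m Φ y).trans (herr n m))).1
      have h4 : q n m W + δ / 2 ≤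
          (n * (a n m : ℝ) ^ p + ((m * (n * 2) ^ k : ℕ) + (m - numSatisfied Φ y) * δ)) - δ / 4 := by
        have : (numSatisfied Φ y : ℝ) + 1 ≤ ((W : ℕ) : ℝ) := by exact_mod_cast hP y
        simp only [q, N]
        nlinarith
      have h6 := mul_le_mul_of_nonneg_left h4 h5
      rw [mul_sub] at h6
      exact h6.trans (by linarith)
    · refine le_trans ?_ (le_gadgetNorm_rpow hp (a n m) _ _ _ Φ hj)
      refine mul_le_mul_of_nonneg_left ?_ h5
      have h3 : (a n m : ℝ) ≤ (a n m : ℝ) ^ p := by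
        simpa using Real.rpow_le_rpow_of_exponent_le (ha1 n m) hp
      have h4 : (a n m : ℝ) = N n m + (m + 1) * Δ + 1 := by simp [a]
      have h6 : (0 : ℝ) ≤ (W : ℕ) := by positivity
      have h7 : (0 : ℝ) ≤ m := by positivity
      have h8 : (0 : ℝ) ≤ N n m := by positivity
      simp only [q]
      nlinarith
  · rintro C ⟨hC, hCe⟩
    exact ⟨C, fun n m Φ W => hCe n m Φ W, hC⟩

/-! ### Hardness -/

theorem Algorithm.RunsIn.mono {A : Algorithm} {T T' : ℕ → ℝ} (h : A.RunsIn T)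
    (hT : ∀ n, T n ≤ T' n) : A.RunsIn T' := by
  obtain ⟨c, hc⟩ := h
  exact ⟨c, fun n d b B hB => (hc n d b B hB).trans
    (mul_le_mul_of_nonneg_right (hT n) (by positivity))⟩

theorem expBound_anti {ε ε' : ℝ} (h : ε ≤ ε') (n : ℕ) : expBound ε' n ≤ expBound ε n :=
  Real.rpow_le_rpow_of_exponent_le one_le_two
    (mul_le_mul_of_nonneg_right (by linarith) (Nat.cast_nonneg n))

theorem one_le_expBound {ε : ℝ} (h : ε ≤ 1) (n : ℕ) : 1 ≤ expBound ε n :=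
  Real.one_le_rpow one_le_two (mul_nonneg (by linarith) (Nat.cast_nonneg n))

/-- The running time of a subexponential algorithm may be taken to be at least `1`. -/
theorem SolvableInSubexp.exists_one_le {p : ENNReal} {γ : ℝ} (h : SolvableInSubexp p γ) :
    ∃ (A : Algorithm) (f : ℕ → ℝ), f =o[atTop] (fun n : ℕ => (n : ℝ)) ∧
      (∀ n, 1 ≤ twoPow f n) ∧ A.Solves p γ ∧ A.RunsIn (twoPow f) := by
  obtain ⟨A, f, hf, hA, hrun⟩ := h
  exact ⟨A, fun n => |f n|, hf.norm_left, fun n => Real.one_le_rpow one_le_two (abs_nonneg _), hA,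
    hrun.mono fun n => Real.rpow_le_rpow_of_exponent_le one_le_two (le_abs_self _)⟩

theorem MaxSatFamily.Solves.exists_satFamily {k : ℕ} {T : ℕ → ℝ} (hT : ∀ n, 1 ≤ T n)
    {C : MaxSatFamily k} (hC : C.Solves) (hs : C.HasSize T) :
    ∃ C' : SatFamily k, C'.Solves ∧ C'.HasSize T := by
  obtain ⟨C', h1, h2⟩ := CVPP.exists_satFamily hT hs
  refine ⟨C', fun n m Φ => ?_, h1⟩
  rw [h2, hC]
  refine exists_congr fun y => ?_
  have h3 : numSatisfied Φ y ≤ m := (Finset.card_le_univ _).trans (by simp)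
  have h4 : numSatisfied Φ y = m ↔ ∀ i, SatisfiesClause y (Φ i) := by
    have := Finset.card_eq_iff_eq_univ (Finset.univ.filter fun i => SatisfiesClause y (Φ i))
    rw [Fintype.card_fin] at this
    rw [numSatisfied, this, Finset.filter_eq_self]
    simp
  rw [← h4, Fin.val_last]
  omega

theorem NonuniformSETH.nonuniformMaxSatSETH (h : NonuniformSETH) : NonuniformMaxSatSETH := by
  intro ε hε
  -- Capping `ε` at 1 keeps the size bound at least 1, so that polynomial additive overhead can be
  -- absorbed.
  obtain ⟨k, hk, hC⟩ := h (min ε 1) (lt_min hε one_pos)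
  refine ⟨k, hk, ?_⟩
  rintro ⟨C, hsol, c, hc⟩
  exact hC (hsol.exists_satFamily (one_le_expBound (min_le_right _ _)) ⟨c, fun n m => (hc n m).trans
    (mul_le_mul_of_nonneg_right (expBound_anti (min_le_left _ _) n) (by positivity))⟩)

theorem NonuniformETH.nonuniformMaxSatETH (h : NonuniformETH) : NonuniformMaxSatETH := by
  rintro ⟨C, f, hf, hsol, c, hc⟩
  obtain ⟨C', h1, h2⟩ := hsol.exists_satFamily (T := twoPow fun n => |f n|)
    (fun n => Real.one_le_rpow one_le_two (abs_nonneg _))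
    ⟨c, fun n m => (hc n m).trans (mul_le_mul_of_nonneg_right
      (Real.rpow_le_rpow_of_exponent_le one_le_two (le_abs_self _)) (by positivity))⟩
  exact h ⟨C', fun n => |f n|, hf.norm_left, h1, h2⟩

theorem not_solvableInExp {p ε : ℝ} (hp : 1 ≤ p) (hp2 : ∀ z : ℤ, p ≠ 2 * (z : ℝ)) (hε : 0 < ε)
    (h : NonuniformMaxSatSETH) : ¬ SolvableInExp (ENNReal.ofReal p) 1 ε := by
  rintro ⟨A, hA, hrun⟩
  obtain ⟨k, -, hC⟩ := h (min ε 1) (lt_min hε one_pos)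
  obtain ⟨d, V, tOn, tOff, hV⟩ := exists_isOnOffIsolating hp (k := k) fun m hm hpm => by
    obtain ⟨j, rfl⟩ := hm
    refine absurd hpm ?_
    have := hp2 j
    push_cast at this ⊢
    rwa [← two_mul]
  exact hC (exists_maxSatFamily_of_onOff hp hV hA (one_le_expBound (min_le_right _ _))
    (hrun.mono (expBound_anti (min_le_left _ _))))

theorem not_solvableInSubexp {p : ℝ} (hp : 1 ≤ p) (hp2 : p ≠ 2) (h : NonuniformMaxSatETH) :
    ¬ SolvableInSubexp (ENNReal.ofReal p) 1 := by
  intro hs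
  obtain ⟨A, f, hf, hT, hA, hrun⟩ := hs.exists_one_le
  -- Three columns on-off require four isolating columns, and every even `p` other than 2 is at
  -- least 4.
  obtain ⟨d, V, tOn, tOff, hV⟩ := exists_isOnOffIsolating hp (k := 3) fun m hm hpm => by
    by_contra! hlt
    subst hpm
    have h1 : 1 ≤ m := by exact_mod_cast hp
    have h2 : m ≠ 2 := by exact_mod_cast hp2
    obtain ⟨j, rfl⟩ := hm
    omega
  obtain ⟨C, h1, h2⟩ := exists_maxSatFamily_of_onOff hp hV hA hT hrun
  exact h ⟨C, f, hf, h1, h2⟩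

theorem not_solvableInSubexp_top (h : NonuniformETH) : ¬ SolvableInSubexp ⊤ 1 := by
  intro hs
  obtain ⟨A, f, hf, hT, hA, hrun⟩ := hs.exists_one_le
  obtain ⟨C, h1, h2⟩ := exists_satFamily_of_top (k := 3) (by norm_num) (by norm_num) hA hT hrun
  exact h ⟨C, f, hf, h1, h2⟩

theorem exists_not_solvableInExp_top {ε : ℝ} (hε : 0 < ε) :
    ∃ γ : ℝ, 1 < γ ∧ (NonuniformSETH → ¬ SolvableInExp ⊤ γ ε) := by
  by_cases h : NonuniformSETH
  · obtain ⟨k, hk, hC⟩ := h (min ε 1) (lt_min hε one_pos)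
    have hk0 : (0 : ℝ) < k := by exact_mod_cast hk
    -- Any factor strictly between 1 and `(k + 1) / k` would do.
    refine ⟨1 + 1 / (2 * k), by linarith [show 0 < 1 / (2 * (k : ℝ)) by positivity], ?_⟩
    rintro - ⟨A, hA, hrun⟩
    refine hC (exists_satFamily_of_top hk ?_ hA (one_le_expBound (min_le_right _ _))
      (hrun.mono (expBound_anti (min_le_left _ _))))
    have : (1 + 1 / (2 * (k : ℝ))) * k = k + 1 / 2 := by field_simp
    linarith
  -- The clause width comes from the hypothesis; if it fails, any factor above 1 works vacuously.
  · exact ⟨2, one_lt_two, fun h' => absurd h' h⟩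

end CVPP

theorem mainTheorem5 :
    -- `p ∈ [1, ∞) ∖ 2ℤ`: no `2 ^ ((1 - ε) n)`-time algorithm
    (∀ p ε : ℝ, 1 ≤ p → (∀ z : ℤ, p ≠ 2 * (z : ℝ)) → 0 < ε →
      (NonuniformMaxSatSETH → ¬ SolvableInExp (ENNReal.ofReal p) 1 ε) ∧
      (NonuniformSETH → ¬ SolvableInExp (ENNReal.ofReal p) 1 ε)) ∧
    -- `p ≥ 1`, `p ≠ 2`: no `2 ^ o(n)`-time algorithm
    (∀ p : ℝ, 1 ≤ p → p ≠ 2 →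
      (NonuniformMaxSatETH → ¬ SolvableInSubexp (ENNReal.ofReal p) 1) ∧
      (NonuniformETH → ¬ SolvableInSubexp (ENNReal.ofReal p) 1)) ∧
    (NonuniformETH → ¬ SolvableInSubexp ⊤ 1) ∧
    -- `p = ∞`: no `2 ^ ((1 - ε) n)`-time algorithm for a constant approximation factor
    (∀ ε : ℝ, 0 < ε → ∃ γ : ℝ, 1 < γ ∧ (NonuniformSETH → ¬ SolvableInExp ⊤ γ ε)) ∧
    -- on-off isolating parallelepipeds and isolating parallelepipeds
    (∀ (p : ℝ) (k : ℕ), 1 ≤ p → 1 ≤ k →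
      ((∃ (d : ℕ) (V : Matrix (Fin d) (Fin k) ℝ) (tOn tOff : Fin d → ℝ),
          IsOnOffIsolating (ENNReal.ofReal p) V tOn tOff) ↔
        ∃ (d : ℕ) (V : Matrix (Fin d) (Fin (k + 1)) ℝ) (t : Fin d → ℝ),
          IsIsolating (ENNReal.ofReal p) V t) ∧
      ((∃ (d : ℕ) (V : Matrix (Fin d) (Fin k) ℝ) (tOn tOff : Fin d → ℝ),
          IsOnOffIsolating (ENNReal.ofReal p) V tOn tOff ∧
          (∀ i j, IsComputableReal (V i j)) ∧
          (∀ i, IsComputableReal (tOn i)) ∧ ∀ i, IsComputableReal (tOff i)) ↔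
        ∃ (d : ℕ) (V : Matrix (Fin d) (Fin (k + 1)) ℝ) (t : Fin d → ℝ),
          IsIsolating (ENNReal.ofReal p) V t ∧
          (∀ i j, IsComputableReal (V i j)) ∧ ∀ i, IsComputableReal (t i))) := by
  refine ⟨fun p ε hp hp2 hε => ⟨not_solvableInExp hp hp2 hε, fun h =>
      not_solvableInExp hp hp2 hε h.nonuniformMaxSatSETH⟩,
    fun p hp hp2 => ⟨not_solvableInSubexp hp hp2, fun h =>
      not_solvableInSubexp hp hp2 h.nonuniformMaxSatETH⟩,
    not_solvableInSubexp_top, fun ε hε => exists_not_solvableInExp_top hε,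
    fun p k _ _ => ⟨⟨?_, ?_⟩, ⟨?_, ?_⟩⟩⟩
  · rintro ⟨d, V, tOn, tOff, h⟩
    exact ⟨d, _, _, h.isIsolating_snoc⟩
  · rintro ⟨d, V, t, h⟩
    exact ⟨d, _, _, _, h.isOnOffIsolating⟩
  · rintro ⟨d, V, tOn, tOff, h, hV, hOn, hOff⟩
    refine ⟨d, _, _, h.isIsolating_snoc, fun i j => ?_, hOn⟩
    refine Fin.lastCases ?_ (fun j => ?_) j
    · simpa using (hOn i).sub (hOff i)
    · simpa using hV i j
  · rintro ⟨d, V, t, h, hV, ht⟩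
    exact ⟨d, _, _, _, h.isOnOffIsolating, fun i j => hV i _, ht, fun i => (ht i).sub (hV i _)⟩
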